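/- Let $n\ge 3$ and $p>\frac{n+2}{n-2}$, and put $\rho(y)=(4\pi)^{-n/2}e^{-|y|^2/4}$ and $G(y,t)=(-4\pi t)^{-n/2}e^{|y|^2/(4t)}$ for $y\in\mathbb R^n$, $t<0$. For $x_0\in\mathbb R^n$, $t_0<0$ let $$F_{x_0,t_0}(w)=\tfrac12(-t_0)^{\frac{p+1}{p-1}}\!\int_{\mathbb R^n}|\nabla w|^2G(y-x_0,t_0)\,dy-\tfrac1{p+1}(-t_0)^{\frac{p+1}{p-1}}\!\int_{\mathbb R^n}|w|^{p+1}G(y-x_0,t_0)\,dy+\tfrac1{2(p-1)}(-t_0)^{\frac2{p-1}}\!\int_{\mathbb R^n}w^2G(y-x_0,t_0)\,dy.$$ Let $w$ be a bounded classical ($C^2$) solution of $$\Delta w-\tfrac y2\cdot\nabla w-\tfrac1{p-1}w+|w|^{p-1}w=0\quad\text{in }\mathbb R^n,$$ let $\phi\in C_0^\infty(\mathbb R^n)$, and let $x(s)\in\mathbb R^n$, $t(s)\in\mathbb R$ be curves that are twice differentiable at $s=0$ with $x(0)=0$, $t(0)=-1$, $x'(0)=y_0$, $t'(0)=h$, $x''(0)=y_0'$,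 $t''(0)=h'$. Write $\Lambda(w)=\frac2{p-1}w+y\cdot\nabla w$ and $$Q(\phi,\phi)=\int_{\mathbb R^n}|\nabla\phi|^2\rho\,dy+\tfrac1{p-1}\int_{\mathbb R^n}\phi^2\rho\,dy-p\int_{\mathbb R^n}|w|^{p-1}\phi^2\rho\,dy.$$ Then the integrals defining $F_{x(s),t(s)}(w+s\phi)$ converge for all $s$ near $0$, the integrals below converge, the function $s\mapsto F_{x(s),t(s)}(w+s\phi)$ is twice differentiable at $s=0$, and $$\frac{d^2}{ds^2}F_{x(s),t(s)}(w+s\phi)\Big|_{s=0}=Q(\phi,\phi)+h\int_{\mathbb R^n}\Lambda(w)\phi\rho\,dy-\int_{\mathbb R^n}\phi(\nabla w\cdot y_0)\rho\,dy-\tfrac12\int_{\mathbb R^n}(\nabla w\cdot y_0)^2\rho\,dy-h^2\int_{\mathbb R^n}\Big(\tfrac1{p-1}w+\tfrac y2\cdot\nabla w\Big)^2\rho\,dy.$$ In particular, $$\frac{d^2}{ds^2}F_{x(s),t(s)}(w+s\phi)\Big|_{s=0}\le Q(\phi,\phi)+h\int_{\mathbb R^n}\Lambda(w)\phi\rho\,dy-\int_{\mathbb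 R^n}\phi(\nabla w\cdot y_0)\rho\,dy.$$ -/

import Mathlib

open MeasureTheory Filter Topology
open scoped ContDiff

noncomputable section

namespace SelfSimilar

/-- Euclidean space `ℝⁿ`. -/
abbrev Eucl (n : ℕ) : Type := EuclideanSpace ℝ (Fin n)

/-- The backward heat kernel `G(y, t) = (-4πt)^{-n/2} e^{|y|²/(4t)}`, used for `t < 0`. -/
def heatKernel {n : ℕ} (y : Eucl n) (t : ℝ) : ℝ :=
  (-4 * Real.pi * t) ^ (-(n : ℝ) / 2) * Real.exp (‖y‖ ^ 2 / (4 * t))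

/-- The Gaussian weight `ρ(y) = (4π)^{-n/2} e^{-|y|²/4}`. -/
def rho {n : ℕ} (y : Eucl n) : ℝ :=
  (4 * Real.pi) ^ (-(n : ℝ) / 2) * Real.exp (-‖y‖ ^ 2 / 4)

theorem heatKernel_neg_one {n : ℕ} (y : Eucl n) : heatKernel y (-1) = rho y := by
  unfold heatKernel rho
  congr 2 <;> ring

/-- The functional `F_{x₀,t₀}(w)`, used for `t₀ < 0`. -/
def functionalF {n : ℕ} (p : ℝ) (x₀ : Eucl n) (t₀ : ℝ) (w : Eucl n → ℝ) : ℝ :=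
  1 / 2 * (-t₀) ^ ((p + 1) / (p - 1)) * (∫ y, ‖gradient w y‖ ^ 2 * heatKernel (y - x₀) t₀)
    - 1 / (p + 1) * (-t₀) ^ ((p + 1) / (p - 1)) *
        (∫ y, |w y| ^ (p + 1) * heatKernel (y - x₀) t₀)
    + 1 / (2 * (p - 1)) * (-t₀) ^ (2 / (p - 1)) * (∫ y, w y ^ 2 * heatKernel (y - x₀) t₀)

/-- The three integrals in `F_{x₀,t₀}(w)` converge. -/
def FiniteF {n : ℕ} (p : ℝ) (x₀ : Eucl n) (t₀ : ℝ) (w : Eucl n → ℝ) : Prop :=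
  Integrable (fun y => ‖gradient w y‖ ^ 2 * heatKernel (y - x₀) t₀) ∧
  Integrable (fun y => |w y| ^ (p + 1) * heatKernel (y - x₀) t₀) ∧
  Integrable (fun y => w y ^ 2 * heatKernel (y - x₀) t₀)

/-- `w` is a bounded classical solution of
`Δw - (y/2)·∇w - w/(p-1) + |w|^{p-1} w = 0` in `ℝⁿ`. -/
structure IsBoundedSolution {n : ℕ} (p : ℝ) (w : Eucl n → ℝ) : Prop where
  contDiff : ContDiff ℝ 2 w
  bounded : ∃ M : ℝ, ∀ y, |w y| ≤ M
  equation : ∀ y, Laplacian.laplacian w y - 1 / 2 * inner ℝ y (gradient w y)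
    - 1 / (p - 1) * w y + |w y| ^ (p - 1) * w y = 0

/-- `Λ(w)(y) = (2/(p-1)) w(y) + y·∇w(y)`, the generator of dilations. -/
def Lam {n : ℕ} (p : ℝ) (w : Eucl n → ℝ) (y : Eucl n) : ℝ :=
  2 / (p - 1) * w y + inner ℝ y (gradient w y)

/-- The quadratic form
`Q(φ,φ) = ∫ |∇φ|² ρ + (1/(p-1)) ∫ φ² ρ - p ∫ |w|^{p-1} φ² ρ`. -/
def quadQ {n : ℕ} (p : ℝ) (w φ : Eucl n → ℝ) : ℝ :=
  (∫ y, ‖gradient φ y‖ ^ 2 * rho y) + 1 / (p - 1) * (∫ y, φ y ^ 2 * rho y)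
    - p * (∫ y, |w y| ^ (p - 1) * φ y ^ 2 * rho y)

/-- The curve `c`, defined near `0`, passes through `a` at `0`, is twice differentiable at `0`, and
`c'(0) = v`, `c''(0) = v'`. (Only the germ of `c` at `0` matters.) -/
structure IsVariation {V : Type*} [NormedAddCommGroup V] [NormedSpace ℝ V]
    (c : ℝ → V) (a v v' : V) : Prop where
  value : c 0 = a
  differentiable_near : ∀ᶠ s in 𝓝 (0 : ℝ), DifferentiableAt ℝ c s
  deriv_zero : deriv c 0 = v
  second_deriv : HasDerivAt (deriv c) v' 0

end SelfSimilar

end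

/-! The time prefactor can be merged with the heat kernel: `(-t)^α G(y - x, t)` is `exp (κ + τ|y|² +
b·y)`, where `κ`, `τ`, `b` are explicit functions of `x` and `t` and the weight at `s = 0` is `ρ`.
Each of the three integrals in `F` is then a Gaussian integral whose weight and integrand both vary,
and `DominatedFamily.isVariation_integral` gives its second derivative. The sum is `∫ secondDensity
ρ`, which still contains `x''(0)`, `t''(0)` and many terms absent from the answer.

These terms disappear because the equation for `w` makes it stationary under perturbations,
translations and dilations. At the level of densities, `secondDensity - variationDensity` is a
weighted divergence `div Z - (y/2)·Z` of a single field `Z` (`noetherField`). It combines the stress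
tensor contracted with a polynomial field `X` (translations and dilations), multiples of `w∇w` and
`φ∇w` (the equation tested with `w` and `φ`), and a `w²Y` term. The pointwise identity is
`secondDensity_sub_variationDensity`; since `∇ρ = -(y/2)ρ`, integrating it against `ρ` gives zero.

The analytic input is that `∇w`, on which no pointwise bound is assumed, is square integrable
against every Gaussian. This is a Caccioppoli estimate (`gaussIntegrable_norm_gradient_sq`),
available since `w` is bounded and `Δw` is controlled by a constant plus `|y||∇w|`. Every integrand
and field is at most quadratic in `∇w` with polynomially bounded coefficients, so domination and the
absence of boundary terms follow from it. The final inequality drops two integrals of squares that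
enter with a minus sign. -/

namespace SelfSimilar

section

/-! ### The divergence of a vector field -/

/-- The divergence of a vector field on `ℝⁿ`. -/
noncomputable def divg {n : ℕ} (Z : Eucl n → Eucl n) (y : Eucl n) : ℝ :=
  ∑ i, inner ℝ (EuclideanSpace.basisFun (Fin n) ℝ i)
    (fderiv ℝ Z y (EuclideanSpace.basisFun (Fin n) ℝ i))

variable {n : ℕ}

theorem divg_smul {f : Eucl n → ℝ} {X : Eucl n → Eucl n} {y : Eucl n}
    (hf : DifferentiableAt ℝ f y) (hX : DifferentiableAt ℝ X y) :
    divg (fun z => f z • X z) y = f y * divg X y + fderiv ℝ f y (X y) := by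
  have h1 : fderiv ℝ f y (X y) = ∑ i, inner ℝ (EuclideanSpace.basisFun (Fin n) ℝ i) (X y) *
      fderiv ℝ f y (EuclideanSpace.basisFun (Fin n) ℝ i) := by
    conv_lhs => rw [← (EuclideanSpace.basisFun (Fin n) ℝ).sum_repr' (X y)]
    simp only [map_sum, map_smul, smul_eq_mul]
  rw [h1]
  unfold divg
  rw [Finset.mul_sum, ← Finset.sum_add_distrib]
  refine Finset.sum_congr rfl fun i _ => ?_
  rw [fderiv_fun_smul hf hX]
  simp only [_root_.add_apply, _root_.smul_apply,
    ContinuousLinearMap.smulRight_apply, inner_add_right, real_inner_smul_right]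
  ring

theorem divg_add {X Y : Eucl n → Eucl n} {y : Eucl n}
    (hX : DifferentiableAt ℝ X y) (hY : DifferentiableAt ℝ Y y) :
    divg (fun z => X z + Y z) y = divg X y + divg Y y := by
  unfold divg
  rw [← Finset.sum_add_distrib]
  refine Finset.sum_congr rfl fun i _ => ?_
  rw [fderiv_fun_add hX hY, _root_.add_apply, inner_add_right]

theorem divg_sub {X Y : Eucl n → Eucl n} {y : Eucl n}
    (hX : DifferentiableAt ℝ X y) (hY : DifferentiableAt ℝ Y y) :
    divg (fun z => X z - Y z) y = divg X y - divg Y y := by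
  unfold divg
  rw [← Finset.sum_sub_distrib]
  refine Finset.sum_congr rfl fun i _ => ?_
  rw [fderiv_fun_sub hX hY, _root_.sub_apply, inner_sub_right]

theorem divg_const (c : Eucl n) (y : Eucl n) : divg (fun _ => c) y = 0 := by
  simp [divg]

theorem divg_id (y : Eucl n) : divg (fun z : Eucl n => z) y = n := by
  simp [divg, -EuclideanSpace.basisFun_apply]

theorem contDiff_gradient {w : Eucl n → ℝ} (hw : ContDiff ℝ 2 w) : ContDiff ℝ 1 (gradient w) := by
  have : gradient w = fun y => (InnerProductSpace.toDual ℝ (Eucl n)).symm (fderiv ℝ w y) := rfl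
  rw [this]
  exact (InnerProductSpace.toDual ℝ (Eucl n)).symm.toContinuousLinearEquiv.contDiff.comp
    (hw.fderiv_right (by norm_num))

/-- Obtained by differentiating `⟨∇w, b⟩ = Dw(b)` with `b` fixed. -/
theorem inner_fderiv_gradient {w : Eucl n → ℝ} (hw : ContDiff ℝ 2 w) (y a b : Eucl n) :
    inner ℝ (fderiv ℝ (gradient w) y a) b = fderiv ℝ (fderiv ℝ w) y a b := by
  have h1 : DifferentiableAt ℝ (gradient w) y :=
    (contDiff_gradient hw).differentiable (by norm_num) y
  have h2 : DifferentiableAt ℝ (fderiv ℝ w) y :=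
    (hw.fderiv_right (m := 1) (by norm_num)).differentiable (by norm_num) y
  have h3 : (fun z => inner ℝ (gradient w z) b) = fun z => fderiv ℝ w z b := by
    funext z; exact inner_gradient_left
  have h4 := congrArg (fun f => fderiv ℝ f y a) h3
  rw [fderiv_inner_apply ℝ h1 (differentiableAt_const b),
    fderiv_clm_apply h2 (differentiableAt_const b)] at h4
  simpa using h4

/-- Symmetry of the Hessian; this is what cancels second derivatives in the divergence of the stress
tensor. -/
theorem inner_fderiv_gradient_comm {w : Eucl n → ℝ} (hw : ContDiff ℝ 2 w) (y a b : Eucl n) :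
    inner ℝ (fderiv ℝ (gradient w) y a) b = inner ℝ (fderiv ℝ (gradient w) y b) a := by
  rw [inner_fderiv_gradient hw, inner_fderiv_gradient hw]
  exact (hw.contDiffAt.isSymmSndFDerivAt (by simp)) a b

theorem divg_gradient {w : Eucl n → ℝ} (hw : ContDiff ℝ 2 w) (y : Eucl n) :
    divg (gradient w) y = Laplacian.laplacian w y := by
  rw [InnerProductSpace.laplacian_eq_iteratedFDeriv_orthonormalBasis w
    (EuclideanSpace.basisFun (Fin n) ℝ)]
  refine Finset.sum_congr rfl fun i _ => ?_
  rw [real_inner_comm, inner_fderiv_gradient hw, iteratedFDeriv_two_apply]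
  rfl

/-- The divergence of the stress tensor `∇w ⊗ ∇w - ½|∇w|² I` contracted with a field `X`. -/
theorem divg_stress {w : Eucl n → ℝ} (hw : ContDiff ℝ 2 w) {X : Eucl n → Eucl n} {y : Eucl n}
    (hX : DifferentiableAt ℝ X y) :
    divg (fun z => inner ℝ (gradient w z) (X z) • gradient w z
        - (1 / 2 * ‖gradient w z‖ ^ 2) • X z) y
      = inner ℝ (gradient w y) (X y) * Laplacian.laplacian w y
        + inner ℝ (gradient w y) (fderiv ℝ X y (gradient w y))
        - 1 / 2 * ‖gradient w y‖ ^ 2 * divg X y := by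
  have hg : DifferentiableAt ℝ (gradient w) y :=
    (contDiff_gradient hw).differentiable (by norm_num) y
  have h1 : DifferentiableAt ℝ (fun z => inner ℝ (gradient w z) (X z)) y := hg.inner ℝ hX
  have h2 : DifferentiableAt ℝ (fun z => 1 / 2 * ‖gradient w z‖ ^ 2) y :=
    (hg.norm_sq ℝ).const_mul _
  have h3 : fderiv ℝ (fun z => 1 / 2 * ‖gradient w z‖ ^ 2) y (X y)
      = inner ℝ (fderiv ℝ (gradient w) y (X y)) (gradient w y) := by
    simp_rw [← real_inner_self_eq_norm_sq]
    rw [fderiv_const_mul (hg.inner ℝ hg), _root_.smul_apply,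
      fderiv_inner_apply ℝ hg hg, real_inner_comm (fderiv ℝ (gradient w) y (X y))]
    simp only [smul_eq_mul]; ring
  -- The two Hessian terms `⟨D(∇w)(∇w), X⟩` and `⟨D(∇w)(X), ∇w⟩` are equal and cancel, so second
  -- derivatives survive only in `Δw`.
  rw [divg_sub (h1.fun_smul hg) (h2.fun_smul hX), divg_smul h1 hg, divg_smul h2 hX, divg_gradient hw,
    h3, fderiv_inner_apply ℝ hg hX, inner_fderiv_gradient_comm hw y (X y)]
  ring

/-! ### The divergence theorem on the whole space. -/

theorem continuous_divg {Z : Eucl n → Eucl n} (hZ : ContDiff ℝ 1 Z) : Continuous (divg Z) := by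
  unfold divg
  refine continuous_finsetSum _ fun i _ => ?_
  exact continuous_const.inner ((hZ.continuous_fderiv (by norm_num)).clm_apply continuous_const)

theorem integral_divg_eq_zero_of_hasCompactSupport {Z : Eucl n → Eucl n} (hZ : ContDiff ℝ 1 Z)
    (hc : HasCompactSupport Z) : ∫ y, divg Z y = 0 := by
  have hd : Continuous (fderiv ℝ Z) := hZ.continuous_fderiv (by norm_num)
  have hint : ∀ v, Integrable (fun y => fderiv ℝ Z y v) := fun v =>
    (hd.clm_apply continuous_const).integrable_of_hasCompactSupport
      (hc.fderiv_apply (𝕜 := ℝ) v)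
  have key : ∀ v, ∫ y, fderiv ℝ Z y v = 0 := by
    intro v
    -- Integration by parts against the constant function 1, whose derivative vanishes.
    have := integral_smul_fderiv_eq_neg_fderiv_smul_of_integrable (μ := (volume : Measure (Eucl n)))
      (f := fun _ : Eucl n => (1 : ℝ)) (g := Z) (v := v)
      (by simp) (by simpa using hint v)
      (by simpa using hZ.continuous.integrable_of_hasCompactSupport hc)
      (fun x _ => differentiableAt_const _) (fun x _ => hZ.differentiable (by norm_num) x)
    simpa using this
  unfold divg
  rw [integral_finsetSum _ fun i _ => (hint _).const_inner _]
  refine Finset.sum_eq_zero fun i _ => ?_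
  rw [integral_inner (hint _), key, inner_zero_right]

/-- A sequence of smooth cut-off functions with gradients tending uniformly to zero. -/
theorem exists_cutoff (n : ℕ) : ∃ (η : ℕ → Eucl n → ℝ) (C : ℝ), 0 ≤ C ∧
    (∀ k, ContDiff ℝ ∞ (η k)) ∧ (∀ k, HasCompactSupport (η k)) ∧
    (∀ k y, 0 ≤ η k y) ∧ (∀ k y, η k y ≤ 1) ∧
    (∀ (k : ℕ) y, ‖y‖ ≤ k + 1 → η k y = 1) ∧
    (∀ (k : ℕ) y, ‖fderiv ℝ (η k) y‖ ≤ C / (k + 1)) := by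
  -- One fixed bump rescaled by `k + 1`: the plateau grows like `k + 1` while the gradient shrinks
  -- by the same factor.
  let f : ContDiffBump (0 : Eucl n) := ⟨1, 2, by norm_num, by norm_num⟩
  have hf : ContDiff ℝ ∞ f := f.contDiff
  obtain ⟨C, hC⟩ := (f.hasCompactSupport.fderiv (𝕜 := ℝ)).exists_bound_of_continuous
    (hf.continuous_fderiv (by simp))
  have hC0 : 0 ≤ C := (norm_nonneg _).trans (hC 0)
  have hpos : ∀ k : ℕ, (0 : ℝ) < k + 1 := fun k => by positivity
  refine ⟨fun k y => f (((k : ℝ) + 1)⁻¹ • y), C, hC0, fun k => ?_, fun k => ?_, fun k y => f.nonneg,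
    fun k y => f.le_one, fun k y hy => ?_, fun k y => ?_⟩
  · exact hf.comp (contDiff_const_smul _)
  · exact f.hasCompactSupport.comp_homeomorph (Homeomorph.smulOfNeZero _ (inv_ne_zero (hpos k).ne'))
  · apply f.one_of_mem_closedBall
    rw [mem_closedBall_zero_iff, norm_smul, norm_inv, Real.norm_of_nonneg (hpos k).le]
    show _ ≤ (1 : ℝ)
    rw [inv_mul_le_iff₀ (hpos k)]
    simpa using hy
  · have h1 : HasFDerivAt (fun z : Eucl n => ((k : ℝ) + 1)⁻¹ • z)
        (((k : ℝ) + 1)⁻¹ • ContinuousLinearMap.id ℝ (Eucl n)) y :=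
      (hasFDerivAt_id y).fun_const_smul _
    have h2 := ((hf.differentiable (by simp) (((k : ℝ) + 1)⁻¹ • y)).hasFDerivAt).comp y h1
    have h3 : fderiv ℝ (fun z => f (((k : ℝ) + 1)⁻¹ • z)) y =
        ((k : ℝ) + 1)⁻¹ • fderiv ℝ f (((k : ℝ) + 1)⁻¹ • y) := by
      rw [HasFDerivAt.fderiv (f := fun z => f (((k : ℝ) + 1)⁻¹ • z)) h2]
      ext v; simp
    rw [h3, norm_smul, norm_inv, Real.norm_of_nonneg (hpos k).le, div_eq_inv_mul]
    exact mul_le_mul_of_nonneg_left (hC _) (inv_nonneg.2 (hpos k).le)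

/-- The divergence theorem on the whole space, without boundary term, for an integrable field
with integrable divergence. -/
theorem integral_divg_eq_zero {Z : Eucl n → Eucl n} (hZ : ContDiff ℝ 1 Z) (hi : Integrable Z)
    (hd : Integrable (divg Z)) : ∫ y, divg Z y = 0 := by
  obtain ⟨η, C, hC, hη, hηc, hη0, hη1, hηe, hηd⟩ := exists_cutoff n
  have hηm : ∀ k, Continuous (fderiv ℝ (η k)) := fun k => (hη k).continuous_fderiv (by simp)
  have i2 : ∀ k, Integrable (fun y => fderiv ℝ (η k) y (Z y)) := by
    intro k
    refine (hi.norm.const_mul (C / (k + 1))).mono'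
      ((hηm k).clm_apply hZ.continuous).aestronglyMeasurable (Eventually.of_forall fun y => ?_)
    exact ((fderiv ℝ (η k) y).le_opNorm _).trans
      (mul_le_mul_of_nonneg_right (hηd k y) (norm_nonneg _))
  have i1 : ∀ k, Integrable (fun y => η k y * divg Z y) := by
    intro k
    refine hd.norm.mono' ((hη k).continuous.mul (continuous_divg hZ)).aestronglyMeasurable
      (Eventually.of_forall fun y => ?_)
    rw [norm_mul, Real.norm_of_nonneg (hη0 k y)]
    exact mul_le_of_le_one_left (norm_nonneg _) (hη1 k y)
  -- By the product rule the cut-off costs only the term `Dη_k(Z)`, bounded by `C|Z|/(k+1)`; it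
  -- tends to zero because `Z` is integrable.
  have h0 : ∀ k, ∫ y, η k y * divg Z y = - ∫ y, fderiv ℝ (η k) y (Z y) := by
    intro k
    have h := integral_divg_eq_zero_of_hasCompactSupport (Z := fun y => η k y • Z y)
      (((hη k).of_le (by exact_mod_cast le_top)).smul hZ) ((hηc k).smul_right)
    have h' : ∀ y, divg (fun y => η k y • Z y) y = η k y * divg Z y + fderiv ℝ (η k) y (Z y) :=
      fun y => divg_smul ((hη k).differentiable (by simp) y) (hZ.differentiable (by norm_num) y)
    simp_rw [h'] at h
    rw [integral_add (i1 k) (i2 k)] at h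
    linarith
  have t1 : Tendsto (fun k => ∫ y, η k y * divg Z y) atTop (𝓝 (∫ y, divg Z y)) := by
    refine tendsto_integral_of_dominated_convergence (fun y => ‖divg Z y‖)
      (fun k => (i1 k).aestronglyMeasurable) hd.norm (fun k => Eventually.of_forall fun y => ?_)
      (Eventually.of_forall fun y => ?_)
    · rw [norm_mul, Real.norm_of_nonneg (hη0 k y)]
      exact mul_le_of_le_one_left (norm_nonneg _) (hη1 k y)
    · refine tendsto_const_nhds.congr' ?_
      obtain ⟨K, hK⟩ := exists_nat_ge ‖y‖
      filter_upwards [eventually_ge_atTop K] with k hk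
      rw [hηe k y, one_mul]
      have : (K : ℝ) ≤ k := by exact_mod_cast hk
      linarith
  have t2 : Tendsto (fun k => ∫ y, η k y * divg Z y) atTop (𝓝 0) := by
    have b : Tendsto (fun k : ℕ => C * (1 / ((k : ℝ) + 1)) * ∫ y, ‖Z y‖) atTop (𝓝 0) := by
      simpa using ((tendsto_one_div_add_atTop_nhds_zero_nat (𝕜 := ℝ)).const_mul C).mul_const
        (∫ y, ‖Z y‖)
    refine squeeze_zero_norm (fun k => ?_) b
    rw [h0, norm_neg, ← integral_const_mul]
    refine norm_integral_le_of_norm_le (hi.norm.const_mul _) (Eventually.of_forall fun y => ?_)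
    rw [mul_one_div]
    exact ((fderiv ℝ (η k) y).le_opNorm _).trans
      (mul_le_mul_of_nonneg_right (hηd k y) (norm_nonneg _))
  exact tendsto_nhds_unique t1 t2

end

section

variable {n : ℕ} {E : Type*} [NormedAddCommGroup E]

/-! ### Integrability against Gaussian weights -/

/-- `f` is integrable against every Gaussian weight `e^{-a|y|²}`, `a > 0`. -/
def GaussIntegrable [NormedSpace ℝ E] (f : Eucl n → E) : Prop :=
  ∀ a : ℝ, 0 < a → Integrable fun y => Real.exp (-a * ‖y‖ ^ 2) • f y

/-- Half of the Gaussian exponent pays for the polynomial: `(1+r)^k ≤ k! e^{1+r}` and `r ≤ a r² +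
1/(4a)`. The loss is harmless in `GaussIntegrable`, which asks for every exponent. -/
theorem one_add_pow_mul_exp_le (k : ℕ) {a : ℝ} (ha : 0 < a) {r : ℝ} (hr : 0 ≤ r) :
    (1 + r) ^ k * Real.exp (-(2 * a) * r ^ 2)
      ≤ k.factorial * Real.exp (1 + 1 / (4 * a)) * Real.exp (-a * r ^ 2) := by
  have h1 : (1 + r) ^ k ≤ k.factorial * Real.exp (1 + r) := by
    have := Real.pow_div_factorial_le_exp (1 + r) (by linarith) k
    rwa [div_le_iff₀ (by positivity), mul_comm] at this
  have h2 : r ≤ a * r ^ 2 + 1 / (4 * a) := by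
    have h3 : a * r ^ 2 + 1 / (4 * a) - r = (2 * a * r - 1) ^ 2 / (4 * a) := by
      field_simp; ring
    have : 0 ≤ (2 * a * r - 1) ^ 2 / (4 * a) := by positivity
    linarith
  calc (1 + r) ^ k * Real.exp (-(2 * a) * r ^ 2)
      ≤ k.factorial * Real.exp (1 + r) * Real.exp (-(2 * a) * r ^ 2) :=
        mul_le_mul_of_nonneg_right h1 (Real.exp_pos _).le
    _ = k.factorial * Real.exp (1 + r + -(2 * a) * r ^ 2) := by rw [Real.exp_add (1 + r)]; ring
    _ ≤ k.factorial * Real.exp (1 + 1 / (4 * a) + -a * r ^ 2) := by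
        apply mul_le_mul_of_nonneg_left _ (by positivity)
        apply Real.exp_le_exp.2
        nlinarith
    _ = _ := by rw [Real.exp_add (1 + 1 / (4 * a))]; ring

theorem GaussIntegrable.mono_poly [NormedSpace ℝ E] {g : Eucl n → ℝ} (hg : GaussIntegrable g) {f : Eucl n → E}
    (hf : AEStronglyMeasurable f) (C : ℝ) (k : ℕ) (hC : 0 ≤ C)
    (h : ∀ y, ‖f y‖ ≤ C * (1 + ‖y‖) ^ k * g y) : GaussIntegrable f := by
  intro a ha
  refine ((hg (a / 2) (by positivity)).norm.const_mul
    (C * (k.factorial * Real.exp (1 + 1 / (4 * (a / 2)))))).mono'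
    ((by fun_prop : Continuous fun y : Eucl n =>
      Real.exp (-a * ‖y‖ ^ 2)).aestronglyMeasurable.smul hf) (Eventually.of_forall fun y => ?_)
  have h1 := one_add_pow_mul_exp_le k (a := a / 2) (by positivity) (norm_nonneg y)
  rw [show -(2 * (a / 2)) = -a by ring] at h1
  rw [norm_smul, Real.norm_of_nonneg (Real.exp_pos _).le, norm_smul,
    Real.norm_of_nonneg (Real.exp_pos _).le]
  calc Real.exp (-a * ‖y‖ ^ 2) * ‖f y‖
      ≤ Real.exp (-a * ‖y‖ ^ 2) * (C * (1 + ‖y‖) ^ k * ‖g y‖) := by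
        gcongr
        refine (h y).trans ?_
        gcongr
        exact le_abs_self _
    _ = C * ((1 + ‖y‖) ^ k * Real.exp (-a * ‖y‖ ^ 2)) * ‖g y‖ := by ring
    _ ≤ C * (k.factorial * Real.exp (1 + 1 / (4 * (a / 2))) *
          Real.exp (-(a / 2) * ‖y‖ ^ 2)) * ‖g y‖ := by gcongr
    _ = _ := by ring

theorem GaussIntegrable.aestronglyMeasurable [NormedSpace ℝ E] {f : Eucl n → E}
    (hf : GaussIntegrable f) : AEStronglyMeasurable f := by
  have h1 := (hf 1 one_pos).aestronglyMeasurable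
  have h2 : Continuous fun y : Eucl n => Real.exp (‖y‖ ^ 2) := by fun_prop
  refine (h2.aestronglyMeasurable.smul h1).congr (Eventually.of_forall fun y => ?_)
  simp [smul_smul, ← Real.exp_add]

theorem GaussIntegrable.add [NormedSpace ℝ E] {f g : Eucl n → E} (hf : GaussIntegrable f)
    (hg : GaussIntegrable g) : GaussIntegrable fun y => f y + g y := fun a ha => by
  simpa only [smul_add] using (hf a ha).fun_add (hg a ha)

theorem integrable_fun_sub {f g : Eucl n → E} (hf : Integrable f) (hg : Integrable g) :
    Integrable fun y => f y - g y := hf.sub hg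

theorem GaussIntegrable.sub [NormedSpace ℝ E] {f g : Eucl n → E} (hf : GaussIntegrable f)
    (hg : GaussIntegrable g) : GaussIntegrable fun y => f y - g y := fun a ha => by
  simpa only [smul_sub] using integrable_fun_sub (hf a ha) (hg a ha)

theorem GaussIntegrable.poly_smul [NormedSpace ℝ E] {f : Eucl n → E} (hf : GaussIntegrable f)
    {q : Eucl n → ℝ} (hq : Continuous q) (C : ℝ) (k : ℕ) (hC : 0 ≤ C)
    (h : ∀ y, |q y| ≤ C * (1 + ‖y‖) ^ k) : GaussIntegrable fun y => q y • f y := by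
  have hn : GaussIntegrable fun y => ‖f y‖ := fun a ha => by
    refine (hf a ha).norm.congr (Eventually.of_forall fun y => ?_)
    simp only [norm_smul, smul_eq_mul, Real.norm_of_nonneg (Real.exp_pos _).le]
  refine hn.mono_poly (hq.aestronglyMeasurable.smul hf.aestronglyMeasurable) C k hC fun y => ?_
  rw [norm_smul]
  exact mul_le_mul_of_nonneg_right (h y) (norm_nonneg _)

theorem gaussIntegrable_one : GaussIntegrable (fun _ : Eucl n => (1 : ℝ)) := by
  intro a ha
  have h := (GaussianFourier.integrable_cexp_neg_mul_sq_norm_add (V := Eucl n) (b := (a : ℂ))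
    (by simpa using ha) 0 0).norm
  refine h.congr (Eventually.of_forall fun y => ?_)
  simp [Complex.norm_exp, ← Complex.ofReal_pow]

theorem GaussIntegrable.of_poly_bound [NormedSpace ℝ E] {f : Eucl n → E} (hf : AEStronglyMeasurable f) (C : ℝ)
    (k : ℕ) (hC : 0 ≤ C) (h : ∀ y, ‖f y‖ ≤ C * (1 + ‖y‖) ^ k) : GaussIntegrable f :=
  gaussIntegrable_one.mono_poly hf C k hC (by simpa using h)

/-! ### The Caccioppoli estimate for the gradient. -/

/-- Here `e` is the Gaussian, `t` the cut-off `η`, `u = w`, `g = |∇w|`, `r = |y|`, `L = Δw`, `I =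
y·∇w`, `d = Dη(∇w)`; the inner sum is the divergence of `η² e w ∇w`. Apart from `e t² g²` and the
`g`-free term `MK`, all terms are linear in `g`. Using `t² ≤ t` each carries the product `t g`, and
Young's inequality `(tg)P ≤ (tg)²/2 + P²/2` absorbs them into half of the left side. -/
theorem caccioppoli_pointwise {a C M K e g r t u L I d : ℝ} (ha : 0 ≤ a)
    (hM0 : 0 ≤ M) (hK0 : 0 ≤ K) (he : 0 ≤ e) (hg0 : 0 ≤ g) (hr : 0 ≤ r) (ht0 : 0 ≤ t)
    (ht1 : t ≤ 1) (hu : |u| ≤ M) (hL : |L| ≤ K + r * g) (hI : |I| ≤ r * g) (hd : |d| ≤ C * g) :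
    t ^ 2 * (e * g ^ 2) ≤ 2 * ((t ^ 2 * (e * u) * L + (t ^ 2 * (e * g ^ 2)
      + t ^ 2 * (u * (e * (-a * (2 * I)))) + e * u * (2 * t * d)))
      + e * (1 / 2 * (M * r + 2 * M * C + 2 * a * M * r) ^ 2 + M * K)) := by
  set P := M * r + 2 * M * C + 2 * a * M * r with hP
  have b : ∀ {v B : ℝ}, |v| ≤ B → -(M * B) ≤ u * v := by
    intro v B hv
    have := mul_le_mul hu hv (abs_nonneg _) hM0
    rw [← abs_mul] at this
    exact (abs_le.1 this).1
  have c1 := mul_le_mul_of_nonneg_left (b hL) (mul_nonneg (sq_nonneg t) he)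
  have c2 := mul_le_mul_of_nonneg_left (b (v := -I) (B := r * g) (by rwa [abs_neg]))
    (mul_nonneg (mul_nonneg ha (sq_nonneg t)) he)
  have c3 := mul_le_mul_of_nonneg_left (b hd) (mul_nonneg ht0 he)
  have ht2 : t ^ 2 ≤ t := by nlinarith
  have c4 : t ^ 2 * (e * (M * r * g + M * (2 * a * r * g)))
      ≤ t * (e * (M * r * g + M * (2 * a * r * g))) :=
    mul_le_mul_of_nonneg_right ht2 (by positivity)
  have c5 : t ^ 2 * (e * (M * K)) ≤ 1 * (e * (M * K)) :=
    mul_le_mul_of_nonneg_right (by linarith) (by positivity)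
  have c6 : e * ((t * g) * P) ≤ e * (1 / 2 * (t * g) ^ 2 + 1 / 2 * P ^ 2) :=
    mul_le_mul_of_nonneg_left (by linarith [sq_nonneg (t * g - P)]) he
  have c7 : e * ((t * g) * P) = t * (e * (M * r * g + M * (2 * a * r * g)))
      + 2 * (t * e * (M * (C * g))) := by
    rw [hP]; ring
  linarith

theorem contDiff_gaussian (a : ℝ) : ContDiff ℝ ∞ fun y : Eucl n => Real.exp (-a * ‖y‖ ^ 2) :=
  Real.contDiff_exp.comp (contDiff_const.mul (contDiff_norm_sq ℝ))

theorem fderiv_gaussian (a : ℝ) (y v : Eucl n) :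
    fderiv ℝ (fun y : Eucl n => Real.exp (-a * ‖y‖ ^ 2)) y v
      = Real.exp (-a * ‖y‖ ^ 2) * (-a * (2 * inner ℝ y v)) := by
  have h : HasFDerivAt (fun y : Eucl n => -a * ‖y‖ ^ 2) (-a • (2 • innerSL ℝ y)) y :=
    (hasStrictFDerivAt_norm_sq y).hasFDerivAt.const_mul _
  rw [h.exp.fderiv]
  simp

theorem integrable_divg_of_hasCompactSupport {Z : Eucl n → Eucl n} (hZ : ContDiff ℝ 1 Z)
    (hc : HasCompactSupport Z) : Integrable (divg Z) := by
  refine (continuous_divg hZ).integrable_of_hasCompactSupport (hc.mono' fun y hy => ?_)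
  by_contra hcon
  apply hy
  have : Z =ᶠ[𝓝 y] fun _ => 0 := notMem_tsupport_iff_eventuallyEq.1 hcon
  simp [divg, this.fderiv_eq]

theorem divg_cutoff_gaussian_smul_gradient {w η : Eucl n → ℝ} (hw : ContDiff ℝ 2 w)
    (hη : ContDiff ℝ ∞ η) (a : ℝ) (y : Eucl n) :
    divg (fun y => (η y ^ 2 * (Real.exp (-a * ‖y‖ ^ 2) * w y)) • gradient w y) y =
      η y ^ 2 * (Real.exp (-a * ‖y‖ ^ 2) * w y) * Laplacian.laplacian w y
      + (η y ^ 2 * (Real.exp (-a * ‖y‖ ^ 2) * ‖gradient w y‖ ^ 2)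
        + η y ^ 2 * (w y * (Real.exp (-a * ‖y‖ ^ 2) * (-a * (2 * inner ℝ y (gradient w y)))))
        + Real.exp (-a * ‖y‖ ^ 2) * w y * (2 * η y * fderiv ℝ η y (gradient w y))) := by
  have dη : DifferentiableAt ℝ η y := hη.differentiable (by simp) y
  have dw : DifferentiableAt ℝ w y := hw.differentiable (by norm_num) y
  have de : DifferentiableAt ℝ (fun y : Eucl n => Real.exp (-a * ‖y‖ ^ 2)) y :=
    (contDiff_gaussian a).differentiable (by simp) y
  have dg : DifferentiableAt ℝ (gradient w) y :=
    (contDiff_gradient hw).differentiable (by norm_num) y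
  rw [divg_smul ((dη.fun_pow 2).fun_mul (de.fun_mul dw)) dg, divg_gradient hw,
    fderiv_fun_mul (dη.fun_pow 2) (de.fun_mul dw), fderiv_fun_mul de dw, fderiv_fun_pow 2 dη]
  simp only [_root_.add_apply, _root_.smul_apply, smul_eq_mul, fderiv_gaussian,
    ← real_inner_self_eq_norm_sq (gradient w y), inner_gradient_left]
  simp
  ring

/-- Integrating the pointwise bound removes the divergence. The resulting bound sees `η` only
through the Lipschitz constant `C`, so it is uniform along a sequence of cut-offs. -/
theorem caccioppoli_cutoff {w η : Eucl n → ℝ} (hw : ContDiff ℝ 2 w) {M K C a : ℝ} (ha : 0 < a)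
    (hC : 0 ≤ C) (hM : ∀ y, |w y| ≤ M)
    (hK : ∀ y, |Laplacian.laplacian w y| ≤ K + ‖y‖ * ‖gradient w y‖)
    (hη : ContDiff ℝ ∞ η) (hηc : HasCompactSupport η) (hη0 : ∀ y, 0 ≤ η y) (hη1 : ∀ y, η y ≤ 1)
    (hηd : ∀ y, ‖fderiv ℝ η y‖ ≤ C) :
    ∫ y, η y ^ 2 * (Real.exp (-a * ‖y‖ ^ 2) * ‖gradient w y‖ ^ 2) ≤
      2 * ∫ y : Eucl n, Real.exp (-a * ‖y‖ ^ 2) *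
        (1 / 2 * (M * ‖y‖ + 2 * M * C + 2 * a * M * ‖y‖) ^ 2 + M * K) := by
  have hM0 : 0 ≤ M := (abs_nonneg _).trans (hM 0)
  have hK0 : 0 ≤ K := by simpa using (abs_nonneg _).trans (hK 0)
  have hgr := contDiff_gradient hw
  have hexp := contDiff_gaussian (n := n) a
  have csupp : HasCompactSupport fun y => η y ^ 2 :=
    hηc.comp_left (g := fun x : ℝ => x ^ 2) (by norm_num)
  have hZ : ContDiff ℝ 1 fun y => (η y ^ 2 * (Real.exp (-a * ‖y‖ ^ 2) * w y)) • gradient w y :=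
    (((hη.of_le (by exact_mod_cast le_top)).pow 2).mul
      ((hexp.of_le (by exact_mod_cast le_top)).mul (hw.of_le (by norm_num)))).smul hgr
  have hZc : HasCompactSupport
      fun y => (η y ^ 2 * (Real.exp (-a * ‖y‖ ^ 2) * w y)) • gradient w y :=
    (csupp.mul_right).smul_right
  have hPint : Integrable fun y : Eucl n => Real.exp (-a * ‖y‖ ^ 2) *
      (1 / 2 * (M * ‖y‖ + 2 * M * C + 2 * a * M * ‖y‖) ^ 2 + M * K) := by
    refine GaussIntegrable.of_poly_bound (Continuous.aestronglyMeasurable (by fun_prop))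
      ((M + 2 * M * C + 2 * a * M) ^ 2 + M * K) 2 (by positivity) (fun y => ?_) a ha
    have h1 : M * ‖y‖ + 2 * M * C + 2 * a * M * ‖y‖
        ≤ (M + 2 * M * C + 2 * a * M) * (1 + ‖y‖) := by
      have : 0 ≤ M + 2 * M * C * ‖y‖ + 2 * a * M := by positivity
      linarith
    have h2 := pow_le_pow_left₀ (by positivity) h1 2
    rw [mul_pow] at h2
    have h3 : (1 : ℝ) ≤ (1 + ‖y‖) ^ 2 := one_le_pow₀ (by linarith [norm_nonneg y])
    have h4 : M * K ≤ M * K * (1 + ‖y‖) ^ 2 := le_mul_of_one_le_right (by positivity) h3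
    rw [Real.norm_of_nonneg (by positivity)]
    linarith [sq_nonneg (M * ‖y‖ + 2 * M * C + 2 * a * M * ‖y‖)]
  have hdi := integrable_divg_of_hasCompactSupport hZ hZc
  have hLi : Integrable fun y => η y ^ 2 * (Real.exp (-a * ‖y‖ ^ 2) * ‖gradient w y‖ ^ 2) :=
    ((hη.continuous.pow 2).mul (hexp.continuous.mul
      (hgr.continuous.norm.pow 2))).integrable_of_hasCompactSupport csupp.mul_right
  refine (integral_mono hLi ((hdi.add hPint).const_mul 2) fun y => ?_).trans_eq ?_
  · simp only [Pi.add_apply]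
    rw [divg_cutoff_gaussian_smul_gradient hw hη]
    exact caccioppoli_pointwise ha.le hM0 hK0 (Real.exp_pos _).le (norm_nonneg _)
      (norm_nonneg _) (hη0 y) (hη1 y) (hM y) (hK y) (abs_real_inner_le_norm y _)
      (((fderiv ℝ η y).le_opNorm _).trans (mul_le_mul_of_nonneg_right (hηd y) (norm_nonneg _)))
  · simp only [Pi.add_apply]
    rw [integral_const_mul, integral_add hdi hPint,
      integral_divg_eq_zero_of_hasCompactSupport hZ hZc, zero_add]

/-- A Caccioppoli estimate: the gradient of a bounded function whose Laplacian is controlled by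
a linearly growing drift is square integrable against every Gaussian. -/
theorem gaussIntegrable_norm_gradient_sq {w : Eucl n → ℝ} (hw : ContDiff ℝ 2 w) {M K : ℝ}
    (hM : ∀ y, |w y| ≤ M)
    (hK : ∀ y, |Laplacian.laplacian w y| ≤ K + ‖y‖ * ‖gradient w y‖) :
    GaussIntegrable fun y => ‖gradient w y‖ ^ 2 := by
  intro a ha
  obtain ⟨η, C, hC, hη, hηc, hη0, hη1, hηe, hηd⟩ := exists_cutoff n
  have hcont : Continuous fun y => Real.exp (-a * ‖y‖ ^ 2) * ‖gradient w y‖ ^ 2 :=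
    (contDiff_gaussian a).continuous.mul ((contDiff_gradient hw).continuous.norm.pow 2)
  have hcov : AECover (volume : Measure (Eucl n)) atTop
      (fun k : ℕ => Metric.closedBall (0 : Eucl n) ((k : ℝ) + 1)) :=
    aecover_closedBall (tendsto_atTop_add_const_right _ _ tendsto_natCast_atTop_atTop)
  have hsmall : ∀ k : ℕ, IntegrableOn (fun y => Real.exp (-a * ‖y‖ ^ 2) * ‖gradient w y‖ ^ 2)
      (Metric.closedBall (0 : Eucl n) ((k : ℝ) + 1)) := fun k =>
    hcont.continuousOn.integrableOn_compact (isCompact_closedBall _ _)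
  -- The gradient bound `C/(k+1)` is relaxed to `C`, which makes the estimate independent of `k`;
  -- integrability follows by exhausting space with balls.
  have hbd : ∀ k : ℕ, ∫ y in Metric.closedBall (0 : Eucl n) ((k : ℝ) + 1),
      Real.exp (-a * ‖y‖ ^ 2) * ‖gradient w y‖ ^ 2 ≤ 2 * ∫ y : Eucl n, Real.exp (-a * ‖y‖ ^ 2) *
        (1 / 2 * (M * ‖y‖ + 2 * M * C + 2 * a * M * ‖y‖) ^ 2 + M * K) := by
    intro k
    have csupp : HasCompactSupport fun y => η k y ^ 2 :=
      (hηc k).comp_left (g := fun x : ℝ => x ^ 2) (by norm_num)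
    have hLi : Integrable fun y => η k y ^ 2 * (Real.exp (-a * ‖y‖ ^ 2) * ‖gradient w y‖ ^ 2) :=
      (((hη k).continuous.pow 2).mul hcont).integrable_of_hasCompactSupport csupp.mul_right
    have hle := caccioppoli_cutoff hw ha hC hM hK (hη k) (hηc k) (hη0 k) (hη1 k) fun y =>
      (hηd k y).trans (div_le_self hC (by linarith [(Nat.cast_nonneg k : (0 : ℝ) ≤ k)]))
    refine le_trans (le_of_eq ?_) ((setIntegral_le_integral
      (s := Metric.closedBall (0 : Eucl n) ((k : ℝ) + 1)) hLi
      (Eventually.of_forall fun y => ?_)).trans hle)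
    · refine setIntegral_congr_fun Metric.isClosed_closedBall.measurableSet fun y hy => ?_
      rw [hηe k y (mem_closedBall_zero_iff.1 hy), one_pow, one_mul]
    · have := Real.exp_pos (-a * ‖y‖ ^ 2)
      simp only [Pi.zero_apply]; positivity
  show Integrable fun y => Real.exp (-a * ‖y‖ ^ 2) * ‖gradient w y‖ ^ 2
  refine hcov.integrable_of_integral_bounded_of_nonneg_ae _ hsmall
    (Eventually.of_forall fun y => ?_) (Eventually.of_forall hbd)
  have := Real.exp_pos (-a * ‖y‖ ^ 2)
  positivity

/-! ### Functions of controlled growth -/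

/-- `f` is continuous and bounded by a polynomial in `|y|` times `(1 + |∇w|)^j`. -/
structure HasGrowth (w : Eucl n → ℝ) (j : ℕ) (f : Eucl n → E) : Prop where
  continuous : Continuous f
  bound : ∃ (C : ℝ) (k : ℕ), 0 ≤ C ∧ ∀ y, ‖f y‖ ≤ C * (1 + ‖y‖) ^ k * (1 + ‖gradient w y‖) ^ j

namespace HasGrowth

variable {w : Eucl n → ℝ} {i j : ℕ}

theorem mono {f : Eucl n → E} (hf : HasGrowth w i f) (hij : i ≤ j) : HasGrowth w j f := by
  obtain ⟨hc, C, k, hC, h⟩ := hf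
  refine ⟨hc, C, k, hC, fun y => (h y).trans ?_⟩
  have : (1 : ℝ) ≤ 1 + ‖gradient w y‖ := by linarith [norm_nonneg (gradient w y)]
  gcongr

theorem add {f g : Eucl n → E} (hf : HasGrowth w i f) (hg : HasGrowth w j g) :
    HasGrowth w (max i j) fun y => f y + g y := by
  obtain ⟨hfc, C, k, hC, h⟩ := hf.mono (le_max_left i j)
  obtain ⟨hgc, C', k', hC', h'⟩ := hg.mono (le_max_right i j)
  refine ⟨hfc.add hgc, C + C', max k k', by positivity, fun y => (norm_add_le _ _).trans ?_⟩
  have h1 : (1 : ℝ) ≤ 1 + ‖y‖ := by linarith [norm_nonneg y]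
  rw [add_mul, add_mul]
  refine add_le_add ((h y).trans ?_) ((h' y).trans ?_)
  · gcongr
    exact le_max_left _ _
  · gcongr
    exact le_max_right _ _

theorem smul [NormedSpace ℝ E] {f : Eucl n → ℝ} {g : Eucl n → E} (hf : HasGrowth w i f) (hg : HasGrowth w j g) :
    HasGrowth w (i + j) fun y => f y • g y := by
  obtain ⟨hfc, C, k, hC, h⟩ := hf
  obtain ⟨hgc, C', k', hC', h'⟩ := hg
  refine ⟨hfc.smul hgc, C * C', k + k', by positivity, fun y => ?_⟩
  rw [norm_smul]
  calc ‖f y‖ * ‖g y‖ ≤ (C * (1 + ‖y‖) ^ k * (1 + ‖gradient w y‖) ^ i) *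
        (C' * (1 + ‖y‖) ^ k' * (1 + ‖gradient w y‖) ^ j) :=
        mul_le_mul (h y) (h' y) (norm_nonneg _) (by positivity)
    _ = _ := by ring

theorem mul {f g : Eucl n → ℝ} (hf : HasGrowth w i f) (hg : HasGrowth w j g) :
    HasGrowth w (i + j) fun y => f y * g y := hf.smul hg

theorem inner {f g : Eucl n → Eucl n} (hf : HasGrowth w i f) (hg : HasGrowth w j g) :
    HasGrowth w (i + j) fun y => inner ℝ (f y) (g y) := by
  obtain ⟨hfc, C, k, hC, h⟩ := hf
  obtain ⟨hgc, C', k', hC', h'⟩ := hg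
  refine ⟨hfc.inner hgc, C * C', k + k', by positivity, fun y => (norm_inner_le_norm _ _).trans ?_⟩
  calc ‖f y‖ * ‖g y‖ ≤ (C * (1 + ‖y‖) ^ k * (1 + ‖gradient w y‖) ^ i) *
        (C' * (1 + ‖y‖) ^ k' * (1 + ‖gradient w y‖) ^ j) :=
        mul_le_mul (h y) (h' y) (norm_nonneg _) (by positivity)
    _ = _ := by ring

theorem of_bounded {f : Eucl n → E} (hf : Continuous f) {C : ℝ} (h : ∀ y, ‖f y‖ ≤ C) :
    HasGrowth w 0 f :=
  ⟨hf, C, 0, (norm_nonneg _).trans (h 0), by simpa using h⟩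

theorem of_hasCompactSupport {f : Eucl n → E} (hf : Continuous f) (hc : HasCompactSupport f) :
    HasGrowth w 0 f :=
  let ⟨_, hC⟩ := hc.exists_bound_of_continuous hf
  of_bounded hf hC

theorem gradient_of_hasCompactSupport {φ : Eucl n → ℝ} (hφ : ContDiff ℝ ∞ φ)
    (hc : HasCompactSupport φ) : HasGrowth w 0 (gradient φ) :=
  of_hasCompactSupport (contDiff_gradient (by exact_mod_cast contDiff_infty.1 hφ 2)).continuous
    ((hc.fderiv (𝕜 := ℝ)).comp_left (g := (InnerProductSpace.toDual ℝ (Eucl n)).symm) (map_zero _))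

theorem const (c : E) : HasGrowth w 0 fun _ => c :=
  of_bounded continuous_const fun _ => le_rfl

theorem const_mul (c : ℝ) {f : Eucl n → ℝ} (hf : HasGrowth w j f) :
    HasGrowth w j fun y => c * f y := by
  simpa using (const (w := w) c).mul hf

theorem neg {f : Eucl n → E} (hf : HasGrowth w j f) : HasGrowth w j fun y => -f y :=
  ⟨hf.continuous.neg, by simpa using hf.bound⟩

theorem sub {f g : Eucl n → E} (hf : HasGrowth w i f) (hg : HasGrowth w j g) :
    HasGrowth w (max i j) fun y => f y - g y := by
  simpa only [sub_eq_add_neg] using hf.add hg.neg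

theorem norm {f : Eucl n → E} (hf : HasGrowth w j f) : HasGrowth w j fun y => ‖f y‖ :=
  ⟨hf.continuous.norm, by simpa using hf.bound⟩

theorem norm_sq {f : Eucl n → E} (hf : HasGrowth w j f) : HasGrowth w (j + j) fun y => ‖f y‖ ^ 2 := by
  simpa only [sq] using hf.norm.mul hf.norm

theorem sq {f : Eucl n → ℝ} (hf : HasGrowth w j f) : HasGrowth w (j + j) fun y => f y ^ 2 := by
  simpa only [pow_two] using hf.mul hf

theorem id : HasGrowth w 0 fun y : Eucl n => y :=
  ⟨continuous_id, 1, 1, zero_le_one, fun y => by simp⟩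

theorem gradient_self (hw : ContDiff ℝ 2 w) : HasGrowth w 1 (gradient w) :=
  ⟨(contDiff_gradient hw).continuous, 1, 0, zero_le_one, fun y => by simp⟩

/-- Degree two in `∇w` is what the Caccioppoli estimate can pay for, through `(1+g)² ≤ 2(1+g²)`. -/
theorem gaussIntegrable [NormedSpace ℝ E] {f : Eucl n → E} (hf : HasGrowth w j f) (hj : j ≤ 2)
    (hw : GaussIntegrable fun y => ‖gradient w y‖ ^ 2) : GaussIntegrable f := by
  obtain ⟨hfc, C, k, hC, h⟩ := hf.mono hj
  have h1 : GaussIntegrable fun y => 1 + ‖gradient w y‖ ^ 2 := fun a ha =>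
    ((gaussIntegrable_one a ha).add (hw a ha)).congr
      (Eventually.of_forall fun y => by simp [mul_add])
  refine h1.mono_poly hfc.aestronglyMeasurable (C * 2) k (by positivity) fun y => (h y).trans ?_
  rw [mul_assoc C 2, mul_comm 2, ← mul_assoc C, mul_assoc (C * _)]
  gcongr
  nlinarith [sq_nonneg (1 - ‖gradient w y‖)]

end HasGrowth

theorem GaussIntegrable.integrable_mul_rho {f : Eucl n → ℝ} (hf : GaussIntegrable f) :
    Integrable fun y => f y * rho y := by
  refine ((hf (1 / 4) (by norm_num)).const_mul ((4 * Real.pi) ^ (-(n : ℝ) / 2))).congr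
    (Eventually.of_forall fun y => ?_)
  simp only [rho, smul_eq_mul]
  rw [show -(1 / 4) * ‖y‖ ^ 2 = -‖y‖ ^ 2 / 4 by ring]
  ring

end

section

/-! ### Calculus of twice differentiable curves -/

namespace IsVariation

variable {E F G : Type*} [NormedAddCommGroup E] [NormedSpace ℝ E] [NormedAddCommGroup F]
  [NormedSpace ℝ F] [NormedAddCommGroup G] [NormedSpace ℝ G]

theorem of_hasDerivAt {c c' : ℝ → E} {v' : E} (h : ∀ᶠ s in 𝓝 (0 : ℝ), HasDerivAt c (c' s) s)
    (h' : HasDerivAt c' v' 0) : IsVariation c (c 0) (c' 0) v' where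
  value := rfl
  differentiable_near := h.mono fun _ hs => hs.differentiableAt
  deriv_zero := h.self_of_nhds.deriv
  second_deriv := h'.congr_of_eventuallyEq (h.mono fun _ hs => hs.deriv)

variable {c : ℝ → E} {a v v' : E}

theorem hasDerivAt_near (h : IsVariation c a v v') :
    ∀ᶠ s in 𝓝 (0 : ℝ), HasDerivAt c (deriv c s) s :=
  h.differentiable_near.mono fun _ hs => hs.hasDerivAt

theorem hasDerivAt_zero (h : IsVariation c a v v') : HasDerivAt c v 0 :=
  h.deriv_zero ▸ h.hasDerivAt_near.self_of_nhds

theorem congr {d : ℝ → E} (h : IsVariation c a v v') (hcd : d =ᶠ[𝓝 0] c) :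
    IsVariation d a v v' where
  value := hcd.self_of_nhds.trans h.value
  differentiable_near := (h.differentiable_near.and hcd.eventuallyEq_nhds).mono fun _ hs =>
    hs.1.congr_of_eventuallyEq hs.2
  deriv_zero := hcd.deriv_eq.trans h.deriv_zero
  second_deriv := h.second_deriv.congr_of_eventuallyEq hcd.deriv

theorem const (a : E) : IsVariation (fun _ => a) a 0 0 :=
  of_hasDerivAt (c' := fun _ => 0) (Eventually.of_forall fun s => hasDerivAt_const s a)
    (hasDerivAt_const _ _)

theorem add {d : ℝ → E} {b u u' : E} (hc : IsVariation c a v v') (hd : IsVariation d b u u') :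
    IsVariation (fun s => c s + d s) (a + b) (v + u) (v' + u') := by
  have h := of_hasDerivAt (c := fun s => c s + d s) (c' := fun s => deriv c s + deriv d s)
    ((hc.hasDerivAt_near.and hd.hasDerivAt_near).mono fun s hs => hs.1.fun_add hs.2)
    (hc.second_deriv.fun_add hd.second_deriv)
  rwa [hc.value, hd.value, hc.deriv_zero, hd.deriv_zero] at h

/-- The second-order product rule, stated once so that scalar multiples and squared norms are
instances. -/
theorem bilinear (B : E →L[ℝ] F →L[ℝ] G) {d : ℝ → F} {b u u' : F} (hc : IsVariation c a v v')
    (hd : IsVariation d b u u') :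
    IsVariation (fun s => B (c s) (d s)) (B a b) (B a u + B v b)
      (B a u' + B v u + (B v u + B v' b)) := by
  have h := of_hasDerivAt (c := fun s => B (c s) (d s))
    (c' := fun s => B (c s) (deriv d s) + B (deriv c s) (d s))
    ((hc.hasDerivAt_near.and hd.hasDerivAt_near).mono fun s hs =>
      B.hasDerivAt_of_bilinear (fun _ => hs.1) (fun _ => hs.2))
    ((B.hasDerivAt_of_bilinear (fun _ => hc.hasDerivAt_zero) (fun _ => hd.second_deriv)).fun_add
      (B.hasDerivAt_of_bilinear (fun _ => hc.second_deriv) (fun _ => hd.hasDerivAt_zero)))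
  rwa [hc.value, hd.value, hc.deriv_zero, hd.deriv_zero] at h

theorem smul {c : ℝ → ℝ} {a v v' : ℝ} {d : ℝ → F} {b u u' : F} (hc : IsVariation c a v v')
    (hd : IsVariation d b u u') : IsVariation (fun s => c s • d s) (a • b) (a • u + v • b)
      (a • u' + v • u + (v • u + v' • b)) :=
  bilinear (ContinuousLinearMap.lsmul ℝ ℝ) hc hd

theorem const_mul (k : ℝ) {c : ℝ → ℝ} {a v v' : ℝ} (hc : IsVariation c a v v') :
    IsVariation (fun s => k * c s) (k * a) (k * v) (k * v') := by
  simpa using (const k).smul hc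

theorem norm_sq {n : ℕ} {c : ℝ → Eucl n} {a v v' : Eucl n} (hc : IsVariation c a v v') :
    IsVariation (fun s => ‖c s‖ ^ 2) (‖a‖ ^ 2) (2 * inner ℝ a v)
      (2 * inner ℝ a v' + 2 * ‖v‖ ^ 2) := by
  have h := bilinear (innerSL ℝ) hc hc
  simp only [innerSL_apply_apply ℝ, real_inner_self_eq_norm_sq] at h
  convert h using 1
  · rw [real_inner_comm a v]; ring
  · rw [real_inner_comm a v']; ring

theorem comp {c : ℝ → ℝ} {a v v' : ℝ} (hc : IsVariation c a v v') {g g' : ℝ → ℝ} {g'' : ℝ}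
    (hg : ∀ᶠ z in 𝓝 a, HasDerivAt g (g' z) z) (hg' : HasDerivAt g' g'' a) :
    IsVariation (fun s => g (c s)) (g a) (g' a * v) (g' a * v' + g'' * v ^ 2) := by
  have hct : Tendsto c (𝓝 0) (𝓝 a) := by
    simpa [ContinuousAt, hc.value] using hc.hasDerivAt_zero.continuousAt
  have hg0 : HasDerivAt g' g'' (c 0) := by rwa [hc.value]
  have h := of_hasDerivAt (c := fun s => g (c s)) (c' := fun s => g' (c s) * deriv c s)
    ((hc.hasDerivAt_near.and (hct.eventually hg)).mono fun s hs => hs.2.comp s hs.1)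
    ((hg0.comp 0 hc.hasDerivAt_zero).fun_mul hc.second_deriv)
  simp only [Function.comp_apply, hc.value, hc.deriv_zero] at h
  convert h using 1
  ring

theorem eventually_norm_le (h : IsVariation c a v v') :
    ∀ᶠ s in 𝓝 (0 : ℝ), ‖c s‖ ≤ ‖a‖ + 1 ∧ ‖deriv c s‖ ≤ ‖v‖ + 1 := by
  have h1 : ∀ᶠ s in 𝓝 (0 : ℝ), ‖c s‖ < ‖a‖ + 1 :=
    h.hasDerivAt_zero.continuousAt.norm.eventually_lt_const (by simp [h.value])
  have h2 : ∀ᶠ s in 𝓝 (0 : ℝ), ‖deriv c s‖ < ‖v‖ + 1 :=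
    h.second_deriv.continuousAt.norm.eventually_lt_const (by simp [h.deriv_zero])
  exact (h1.and h2).mono fun s hs => ⟨hs.1.le, hs.2.le⟩

end IsVariation

/-! ### Integrals with a varying Gaussian weight -/

variable {n : ℕ}

/-- The Gaussian weight `e^{κ + τ|y|² + b·y}`. -/
noncomputable def gaussWeight (κ τ : ℝ → ℝ) (b : ℝ → Eucl n) (s : ℝ) (y : Eucl n) : ℝ :=
  Real.exp (κ s + τ s * ‖y‖ ^ 2 + inner ℝ (b s) y)

/-- The logarithmic derivative in `s` of `gaussWeight`. -/
noncomputable def gaussRate (κ τ : ℝ → ℝ) (b : ℝ → Eucl n) (s : ℝ) (y : Eucl n) : ℝ :=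
  deriv κ s + deriv τ s * ‖y‖ ^ 2 + inner ℝ (deriv b s) y

/-- On the open set `U` of parameters the weights `gaussWeight` decay uniformly and their
parameters are differentiable with bounded derivatives. -/
structure UniformWeight (κ τ : ℝ → ℝ) (b : ℝ → Eucl n) (U : Set ℝ) (a B : ℝ) : Prop where
  isOpen : IsOpen U
  pos : 0 < a
  nonneg : 0 ≤ B
  diff : ∀ s ∈ U, DifferentiableAt ℝ κ s ∧ DifferentiableAt ℝ τ s ∧ DifferentiableAt ℝ b s
  le : ∀ s ∈ U, κ s ≤ B ∧ τ s ≤ -(2 * a) ∧ ‖b s‖ ≤ B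
  deriv_le : ∀ s ∈ U, |deriv κ s| ≤ B ∧ |deriv τ s| ≤ B ∧ ‖deriv b s‖ ≤ B

variable {κ τ : ℝ → ℝ} {b : ℝ → Eucl n} {U : Set ℝ} {a B : ℝ}

/-- Differentiability of the first derivatives at `0` makes them continuous there, hence bounded
nearby; `τ` stays below `τ₀/2` by continuity. The restriction to `(-1, 1)` is the parameter range of
`DominatedFamily`. -/
theorem exists_uniformWeight {κ₀ κ₁ κ₂ τ₀ τ₁ τ₂ : ℝ} {b₀ b₁ b₂ : Eucl n}
    (hκ : IsVariation κ κ₀ κ₁ κ₂) (hτ : IsVariation τ τ₀ τ₁ τ₂) (hb : IsVariation b b₀ b₁ b₂)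
    (hτ₀ : τ₀ < 0) : ∃ U a B, (0 : ℝ) ∈ U ∧ U ⊆ Set.Ioo (-1) 1 ∧ UniformWeight κ τ b U a B := by
  have hlt : ∀ᶠ s in 𝓝 (0 : ℝ), τ s < τ₀ / 2 :=
    hτ.hasDerivAt_zero.continuousAt.eventually_lt_const (by rw [hτ.value]; linarith)
  have hall := ((hκ.eventually_norm_le.and hτ.eventually_norm_le).and
    (hb.eventually_norm_le.and hlt)).and ((hκ.differentiable_near.and hτ.differentiable_near).and
    (hb.differentiable_near.and (Ioo_mem_nhds (by norm_num : (-1 : ℝ) < 0) one_pos)))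
  obtain ⟨U, hU, hUo, h0⟩ := eventually_nhds_iff.1 hall
  have n1 := norm_nonneg κ₀
  have n2 := norm_nonneg κ₁
  have n3 := norm_nonneg τ₁
  have n4 := norm_nonneg b₀
  have n5 := norm_nonneg b₁
  -- With `a = -τ₀/4` the required bound `τ ≤ -(2a)` is `τ ≤ τ₀/2`.
  refine ⟨U, -τ₀ / 4, ‖κ₀‖ + ‖κ₁‖ + ‖τ₁‖ + ‖b₀‖ + ‖b₁‖ + 1, h0, fun s hs => (hU s hs).2.2.2,
    hUo, by linarith, by positivity, fun s hs => ?_, fun s hs => ?_, fun s hs => ?_⟩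
  · exact ⟨(hU s hs).2.1.1, (hU s hs).2.1.2, (hU s hs).2.2.1⟩
  · obtain ⟨⟨⟨⟨h1, -⟩, ⟨-, -⟩⟩, ⟨⟨h3, -⟩, h4⟩⟩, -⟩ := hU s hs
    refine ⟨?_, by linarith, by linarith⟩
    have := le_abs_self (κ s)
    rw [Real.norm_eq_abs] at h1
    linarith
  · obtain ⟨⟨⟨⟨-, h1⟩, ⟨-, h2⟩⟩, ⟨⟨-, h3⟩, -⟩⟩, -⟩ := hU s hs
    rw [Real.norm_eq_abs (deriv _ _)] at h1 h2
    exact ⟨by linarith, by linarith, by linarith⟩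

theorem gaussWeight_pos (s : ℝ) (y : Eucl n) : 0 < gaussWeight κ τ b s y := Real.exp_pos _

theorem continuous_gaussWeight (s : ℝ) : Continuous (gaussWeight κ τ b s) := by
  unfold gaussWeight
  fun_prop

theorem continuous_gaussRate (s : ℝ) : Continuous (gaussRate κ τ b s) := by
  unfold gaussRate
  fun_prop

namespace UniformWeight

/-- Half of the decay `e^{-2a|y|²}` absorbs the linear term `b·y` by completing the square. -/
theorem weight_le (W : UniformWeight κ τ b U a B) {s : ℝ} (hs : s ∈ U) (y : Eucl n) :
    gaussWeight κ τ b s y ≤ Real.exp (B + B ^ 2 / (4 * a)) * Real.exp (-a * ‖y‖ ^ 2) := by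
  obtain ⟨h1, h2, h3⟩ := W.le s hs
  have ha := W.pos
  rw [← Real.exp_add]
  apply Real.exp_le_exp.2
  have h4 : inner ℝ (b s) y ≤ B * ‖y‖ :=
    (real_inner_le_norm _ _).trans (mul_le_mul_of_nonneg_right h3 (norm_nonneg _))
  have h5 : τ s * ‖y‖ ^ 2 ≤ -(2 * a) * ‖y‖ ^ 2 := mul_le_mul_of_nonneg_right h2 (sq_nonneg _)
  have h6 : a * ‖y‖ ^ 2 + B ^ 2 / (4 * a) - B * ‖y‖ = (2 * a * ‖y‖ - B) ^ 2 / (4 * a) := by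
    field_simp; ring
  have h7 : 0 ≤ (2 * a * ‖y‖ - B) ^ 2 / (4 * a) := by positivity
  linarith

theorem abs_rate_le (W : UniformWeight κ τ b U a B) {s : ℝ} (hs : s ∈ U) (y : Eucl n) :
    |gaussRate κ τ b s y| ≤ B * (1 + ‖y‖) ^ 2 := by
  obtain ⟨h1, h2, h3⟩ := W.deriv_le s hs
  have h4 : |inner ℝ (deriv b s) y| ≤ B * ‖y‖ :=
    (abs_real_inner_le_norm _ _).trans (mul_le_mul_of_nonneg_right h3 (norm_nonneg _))
  have h5 : |deriv τ s * ‖y‖ ^ 2| ≤ B * ‖y‖ ^ 2 := by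
    rw [abs_mul, abs_of_nonneg (sq_nonneg ‖y‖)]
    exact mul_le_mul_of_nonneg_right h2 (sq_nonneg _)
  have h6 := abs_add_three (deriv κ s) (deriv τ s * ‖y‖ ^ 2) (inner ℝ (deriv b s) y)
  have h7 : 0 ≤ B * ‖y‖ := mul_nonneg W.nonneg (norm_nonneg _)
  unfold gaussRate
  linarith

theorem hasDerivAt_weight (W : UniformWeight κ τ b U a B) {s : ℝ} (hs : s ∈ U) (y : Eucl n) :
    HasDerivAt (fun s => gaussWeight κ τ b s y)
      (gaussWeight κ τ b s y * gaussRate κ τ b s y) s := by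
  obtain ⟨h1, h2, h3⟩ := W.diff s hs
  refine HasDerivAt.exp ((h1.hasDerivAt.fun_add (h2.hasDerivAt.mul_const _)).fun_add ?_)
  simpa using h3.hasDerivAt.inner ℝ (hasDerivAt_const s y)

variable {E : Type*} [NormedAddCommGroup E] [NormedSpace ℝ E]

theorem integrable (W : UniformWeight κ τ b U a B) {f : Eucl n → E} (hf : GaussIntegrable f)
    {s : ℝ} (hs : s ∈ U) : Integrable fun y => gaussWeight κ τ b s y • f y := by
  refine ((hf a W.pos).norm.const_mul (Real.exp (B + B ^ 2 / (4 * a)))).mono'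
    ((continuous_gaussWeight s).aestronglyMeasurable.smul hf.aestronglyMeasurable) (Eventually.of_forall fun y => ?_)
  rw [norm_smul, norm_smul, ← mul_assoc, Real.norm_of_nonneg (Real.exp_pos _).le,
    Real.norm_of_nonneg (gaussWeight_pos s y).le]
  exact mul_le_mul_of_nonneg_right (W.weight_le hs y) (norm_nonneg _)

/-- Differentiation under the integral sign for Gaussian integrals. -/
theorem hasDerivAt_integral (W : UniformWeight κ τ b U a B) {f f' : ℝ → Eucl n → E}
    {g : Eucl n → ℝ} (hg : GaussIntegrable g) (hfm : ∀ s ∈ U, Continuous (f s))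
    (hfm' : ∀ s ∈ U, Continuous (f' s)) (hfb : ∀ s ∈ U, ∀ y, ‖f s y‖ ≤ g y)
    (hfb' : ∀ s ∈ U, ∀ y, ‖f' s y‖ ≤ g y)
    (hd : ∀ s ∈ U, ∀ y, HasDerivAt (fun s => f s y) (f' s y) s) {s : ℝ} (hs : s ∈ U) :
    HasDerivAt (fun s => ∫ y, gaussWeight κ τ b s y • f s y)
      (∫ y, gaussWeight κ τ b s y • (f' s y + gaussRate κ τ b s y • f s y)) s := by
  -- Differentiating the weight costs a factor of at most `B(1+|y|)²`, which this majorant includes.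
  have hg' : GaussIntegrable fun y => (1 + B) * (1 + ‖y‖) ^ 2 * g y := by
    refine hg.poly_smul (by fun_prop) (1 + B) 2 (by linarith [W.nonneg]) fun y => ?_
    have := W.nonneg
    rw [abs_of_nonneg (by positivity)]
  refine (hasDerivAt_integral_of_dominated_loc_of_deriv_le (W.isOpen.mem_nhds hs)
    (F' := fun s y => gaussWeight κ τ b s y • (f' s y + gaussRate κ τ b s y • f s y))
    (bound := fun y => Real.exp (B + B ^ 2 / (4 * a)) *
      (Real.exp (-a * ‖y‖ ^ 2) • ((1 + B) * (1 + ‖y‖) ^ 2 * g y))) ?_ ?_ ?_ ?_ ?_ ?_).2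
  · filter_upwards [W.isOpen.mem_nhds hs] with r hr
    exact ((continuous_gaussWeight r).smul (hfm r hr)).aestronglyMeasurable
  · refine W.integrable (hg.mono_poly (hfm s hs).aestronglyMeasurable 1 0 zero_le_one fun y => ?_) hs
    simpa using hfb s hs y
  · exact ((continuous_gaussWeight s).smul ((hfm' s hs).add
      ((continuous_gaussRate s).smul (hfm s hs)))).aestronglyMeasurable
  · refine Eventually.of_forall fun y r hr => ?_
    have hg0 := (norm_nonneg _).trans (hfb r hr y)
    have hB := W.nonneg
    have h1 : ‖f' r y + gaussRate κ τ b r y • f r y‖ ≤ (1 + B) * (1 + ‖y‖) ^ 2 * g y := by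
      have h2 : ‖gaussRate κ τ b r y • f r y‖ ≤ B * (1 + ‖y‖) ^ 2 * g y := by
        rw [norm_smul]
        exact mul_le_mul (W.abs_rate_le hr y) (hfb r hr y) (norm_nonneg _) (by positivity)
      have h3 : g y ≤ (1 + ‖y‖) ^ 2 * g y :=
        le_mul_of_one_le_left hg0 (one_le_pow₀ (by linarith [norm_nonneg y]))
      have h4 := norm_add_le (f' r y) (gaussRate κ τ b r y • f r y)
      have h5 := hfb' r hr y
      linarith
    rw [norm_smul, Real.norm_of_nonneg (gaussWeight_pos r y).le, smul_eq_mul, ← mul_assoc]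
    exact mul_le_mul (W.weight_le hr y) h1 (norm_nonneg _) (by positivity)
  · exact (hg' a W.pos).const_mul _
  · refine Eventually.of_forall fun y r hr => ?_
    have := (W.hasDerivAt_weight hr y).fun_smul (hd r hr y)
    refine this.congr_deriv ?_
    rw [smul_add, smul_smul]

end UniformWeight

/-! ### Second derivatives of Gaussian integrals. -/

/-- A family of functions, twice differentiable in the parameter `s ∈ (-1, 1)`, all derivatives
being dominated by `g`. -/
structure DominatedFamily (f f' f'' : ℝ → Eucl n → ℝ) (g : Eucl n → ℝ) : Prop where
  gauss : GaussIntegrable g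
  cont : ∀ s ∈ Set.Ioo (-1 : ℝ) 1, Continuous (f s) ∧ Continuous (f' s) ∧ Continuous (f'' s)
  bound : ∀ s ∈ Set.Ioo (-1 : ℝ) 1, ∀ y, |f s y| ≤ g y ∧ |f' s y| ≤ g y ∧ |f'' s y| ≤ g y
  deriv : ∀ s ∈ Set.Ioo (-1 : ℝ) 1, ∀ y, HasDerivAt (fun s => f s y) (f' s y) s
  deriv' : ∀ s ∈ Set.Ioo (-1 : ℝ) 1, ∀ y, HasDerivAt (fun s => f' s y) (f'' s y) s

/-- Separates the coefficients `k`, `t`, `c`, later the derivatives of `κ`, `τ`, `b`, from moment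
integrals that do not involve them. -/
theorem integral_weight_affine {e u v : Eucl n → ℝ} (k t : ℝ) (c : Eucl n)
    (hu : Integrable fun y => e y • u y) (hv : Integrable fun y => e y • v y)
    (hv2 : Integrable fun y => e y • (‖y‖ ^ 2 * v y))
    (hvy : Integrable fun y => e y • (v y • y)) :
    ∫ y, e y • (u y + (k + t * ‖y‖ ^ 2 + inner ℝ c y) * v y) =
      (∫ y, e y • u y) + k * (∫ y, e y • v y) + t * (∫ y, e y • (‖y‖ ^ 2 * v y))
        + inner ℝ c (∫ y, e y • (v y • y)) := by
  rw [← integral_inner hvy, ← integral_const_mul, ← integral_const_mul,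
    ← integral_add hu (hv.const_mul k), ← integral_add _ (hv2.const_mul t),
    ← integral_add _ (hvy.const_inner c)]
  · refine integral_congr_ae (Eventually.of_forall fun y => ?_)
    simp only [smul_eq_mul, real_inner_smul_right]
    ring
  · exact (hu.add (hv.const_mul k)).add (hv2.const_mul t)
  · exact hu.add (hv.const_mul k)

/-- The second derivative of a Gaussian integral with varying weight and integrand. -/
theorem DominatedFamily.isVariation_integral {f f' f'' : ℝ → Eucl n → ℝ} {g : Eucl n → ℝ}
    (hf : DominatedFamily f f' f'' g) {κ₀ κ₁ κ₂ τ₀ τ₁ τ₂ : ℝ} {b₀ b₁ b₂ : Eucl n}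
    (hκ : IsVariation κ κ₀ κ₁ κ₂) (hτ : IsVariation τ τ₀ τ₁ τ₂) (hb : IsVariation b b₀ b₁ b₂)
    (hτ₀ : τ₀ < 0) :
    (∀ᶠ s in 𝓝 (0 : ℝ), Integrable fun y => gaussWeight κ τ b s y * f s y) ∧
    ∃ v, IsVariation (fun s => ∫ y, gaussWeight κ τ b s y * f s y)
      (∫ y, gaussWeight κ τ b 0 y * f 0 y) v
      (∫ y, gaussWeight κ τ b 0 y * (f'' 0 y
        + 2 * (κ₁ + τ₁ * ‖y‖ ^ 2 + inner ℝ b₁ y) * f' 0 y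
        + (κ₂ + τ₂ * ‖y‖ ^ 2 + inner ℝ b₂ y + (κ₁ + τ₁ * ‖y‖ ^ 2 + inner ℝ b₁ y) ^ 2) * f 0 y)) := by
  obtain ⟨U, a, B, h0, hU, W⟩ := exists_uniformWeight hκ hτ hb hτ₀
  have hg := hf.gauss
  have hr : ∀ y : Eucl n, 1 ≤ 1 + ‖y‖ := fun y => by linarith [norm_nonneg y]
  have hG : GaussIntegrable fun y => (1 + ‖y‖) ^ 2 * g y := by
    refine hg.poly_smul (by fun_prop) 1 2 zero_le_one fun y => ?_
    rw [abs_of_nonneg (by positivity), one_mul]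
  have bsq : ∀ y : Eucl n, ∀ t : ℝ, |t| ≤ g y → |‖y‖ ^ 2 * t| ≤ (1 + ‖y‖) ^ 2 * g y := by
    intro y t ht
    rw [abs_mul, abs_of_nonneg (sq_nonneg ‖y‖)]
    exact mul_le_mul (pow_le_pow_left₀ (norm_nonneg _) (by linarith) 2) ht (abs_nonneg _)
      (by positivity)
  have bsm : ∀ y : Eucl n, ∀ t : ℝ, |t| ≤ g y → ‖t • y‖ ≤ (1 + ‖y‖) ^ 2 * g y := by
    intro y t ht
    rw [norm_smul, mul_comm]
    refine mul_le_mul ?_ ht (abs_nonneg _) (by positivity)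
    nlinarith [hr y, norm_nonneg y]
  have D0 : ∀ s ∈ U, _ := fun s hs => W.hasDerivAt_integral hg
    (fun s hs => (hf.cont s (hU hs)).1) (fun s hs => (hf.cont s (hU hs)).2.1)
    (fun s hs y => (hf.bound s (hU hs) y).1) (fun s hs y => (hf.bound s (hU hs) y).2.1)
    (fun s hs => hf.deriv s (hU hs)) hs
  have D1 := W.hasDerivAt_integral hg
    (fun s hs => (hf.cont s (hU hs)).2.1) (fun s hs => (hf.cont s (hU hs)).2.2)
    (fun s hs y => (hf.bound s (hU hs) y).2.1) (fun s hs y => (hf.bound s (hU hs) y).2.2)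
    (fun s hs => hf.deriv' s (hU hs)) h0
  have D2 := W.hasDerivAt_integral (f := fun s y => ‖y‖ ^ 2 * f s y)
    (f' := fun s y => ‖y‖ ^ 2 * f' s y) hG
    (fun s hs => (by fun_prop : Continuous fun y : Eucl n => ‖y‖ ^ 2).mul (hf.cont s (hU hs)).1)
    (fun s hs => (by fun_prop : Continuous fun y : Eucl n => ‖y‖ ^ 2).mul (hf.cont s (hU hs)).2.1)
    (fun s hs y => bsq y _ (hf.bound s (hU hs) y).1)
    (fun s hs y => bsq y _ (hf.bound s (hU hs) y).2.1)
    (fun s hs y => (hf.deriv s (hU hs) y).const_mul _) h0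
  have D3 := W.hasDerivAt_integral (f := fun s y => f s y • y)
    (f' := fun s y => f' s y • y) hG
    (fun s hs => (hf.cont s (hU hs)).1.smul continuous_id)
    (fun s hs => (hf.cont s (hU hs)).2.1.smul continuous_id)
    (fun s hs y => bsm y _ (hf.bound s (hU hs) y).1)
    (fun s hs y => bsm y _ (hf.bound s (hU hs) y).2.1)
    (fun s hs y => (hf.deriv s (hU hs) y).smul_const _) h0
  have gf : ∀ s ∈ U, GaussIntegrable (f s) := fun s hs =>
    hg.mono_poly (hf.cont s (hU hs)).1.aestronglyMeasurable 1 0 zero_le_one fun y => by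
      simpa using (hf.bound s (hU hs) y).1
  have gf' : ∀ s ∈ U, GaussIntegrable (f' s) := fun s hs =>
    hg.mono_poly (hf.cont s (hU hs)).2.1.aestronglyMeasurable 1 0 zero_le_one fun y => by
      simpa using (hf.bound s (hU hs) y).2.1
  have gf'' : GaussIntegrable (f'' 0) :=
    hg.mono_poly (hf.cont 0 (hU h0)).2.2.aestronglyMeasurable 1 0 zero_le_one fun y => by
      simpa using (hf.bound 0 (hU h0) y).2.2
  have g2 : ∀ {v : Eucl n → ℝ}, GaussIntegrable v → GaussIntegrable fun y => ‖y‖ ^ 2 * v y :=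
    fun hv => hv.poly_smul (by fun_prop) 1 2 zero_le_one fun y => by
      rw [abs_of_nonneg (sq_nonneg _), one_mul]
      exact pow_le_pow_left₀ (norm_nonneg _) (by linarith) 2
  have gy : ∀ {v : Eucl n → ℝ}, GaussIntegrable v → GaussIntegrable fun y => v y • y := by
    intro v hv
    have h1 : GaussIntegrable fun y => (1 + ‖y‖) * |v y| := by
      refine GaussIntegrable.poly_smul (f := fun y => |v y|) (fun a ha => ?_) (by fun_prop) 1 1
        zero_le_one fun y => by rw [abs_of_nonneg (by positivity), one_mul, pow_one]
      refine (hv a ha).norm.congr (Eventually.of_forall fun y => ?_)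
      simp only [smul_eq_mul, norm_mul, Real.norm_of_nonneg (Real.exp_pos _).le, Real.norm_eq_abs]
    refine h1.mono_poly (hv.aestronglyMeasurable.smul aestronglyMeasurable_id) 1 0 zero_le_one
      fun y => ?_
    rw [norm_smul, pow_zero, mul_one, one_mul, mul_comm, Real.norm_eq_abs]
    exact mul_le_mul_of_nonneg_right (by linarith) (abs_nonneg _)
  have gr : ∀ {v : Eucl n → ℝ}, GaussIntegrable v →
      GaussIntegrable fun y => gaussRate κ τ b 0 y * v y := fun hv =>
    hv.poly_smul (continuous_gaussRate 0) B 2 W.nonneg (W.abs_rate_le h0)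
  have split : ∀ s ∈ U, ∀ (k t : ℝ) (c : Eucl n) {u v : Eucl n → ℝ}, GaussIntegrable u →
      GaussIntegrable v → _ := fun s hs k t c u v hu hv =>
    integral_weight_affine (e := gaussWeight κ τ b s) k t c (W.integrable hu hs)
      (W.integrable hv hs) (W.integrable (g2 hv) hs) (W.integrable (gy hv) hs)
  -- The derivatives of `κ`, `τ`, `b` are differentiable only at `0`, so the differentiated
  -- integrand cannot be differentiated under the integral over a neighbourhood. Written this way,
  -- the first derivative is a sum of products of these coefficients with moments differentiable at
  -- `0`, and the product rule at the single point `0` suffices.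
  have hder : ∀ᶠ s in 𝓝 (0 : ℝ), HasDerivAt (fun s => ∫ y, gaussWeight κ τ b s y * f s y)
      ((∫ y, gaussWeight κ τ b s y • f' s y) + _root_.deriv κ s * (∫ y, gaussWeight κ τ b s y • f s y)
        + _root_.deriv τ s * (∫ y, gaussWeight κ τ b s y • (‖y‖ ^ 2 * f s y))
        + inner ℝ (_root_.deriv b s) (∫ y, gaussWeight κ τ b s y • (f s y • y))) s := by
    filter_upwards [W.isOpen.mem_nhds h0] with s hs
    rw [← split s hs _ _ _ (gf' s hs) (gf s hs)]
    exact D0 s hs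
  refine ⟨?_, ?_⟩
  · filter_upwards [W.isOpen.mem_nhds h0] with s hs
    exact W.integrable (gf s hs) hs
  have hfin := ((D1.fun_add (hκ.second_deriv.fun_mul (D0 0 h0))).fun_add
    (hτ.second_deriv.fun_mul D2)).fun_add (hb.second_deriv.inner ℝ D3)
  refine ⟨_, IsVariation.of_hasDerivAt hder (hfin.congr_deriv ?_)⟩
  have hrate : ∀ y, gaussRate κ τ b 0 y = κ₁ + τ₁ * ‖y‖ ^ 2 + inner ℝ b₁ y := fun y => by
    rw [gaussRate, hκ.deriv_zero, hτ.deriv_zero, hb.deriv_zero]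
  have g1 : GaussIntegrable fun y => f' 0 y + gaussRate κ τ b 0 y * f 0 y :=
    (gf' 0 h0).add (gr (gf 0 h0))
  have e1 := split 0 h0 κ₁ τ₁ b₁ (gf''.add (gr (gf' 0 h0))) g1
  have e2 := split 0 h0 κ₂ τ₂ b₂ ((gf''.add (gr (gf' 0 h0))).add (gr g1)) (gf 0 h0)
  simp_rw [← hrate] at e1 ⊢
  rw [e1] at e2
  rw [hκ.deriv_zero, hτ.deriv_zero, hb.deriv_zero]
  have e3 : ∀ y, ‖y‖ ^ 2 * f' 0 y + gaussRate κ τ b 0 y • (‖y‖ ^ 2 * f 0 y)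
      = ‖y‖ ^ 2 * (f' 0 y + gaussRate κ τ b 0 y * f 0 y) := fun y => by
    simp only [smul_eq_mul]; ring
  have e4 : ∀ y, f' 0 y • y + gaussRate κ τ b 0 y • f 0 y • y
      = (f' 0 y + gaussRate κ τ b 0 y * f 0 y) • y := fun y => by
    rw [add_smul, smul_smul]
  simp_rw [e3, e4]
  have e5 : ∫ y, gaussWeight κ τ b 0 y * (f'' 0 y + 2 * gaussRate κ τ b 0 y * f' 0 y
        + (κ₂ + τ₂ * ‖y‖ ^ 2 + inner ℝ b₂ y + gaussRate κ τ b 0 y ^ 2) * f 0 y) =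
      ∫ y, gaussWeight κ τ b 0 y • (f'' 0 y + gaussRate κ τ b 0 y * f' 0 y +
        gaussRate κ τ b 0 y * (f' 0 y + gaussRate κ τ b 0 y * f 0 y) +
        (κ₂ + τ₂ * ‖y‖ ^ 2 + inner ℝ b₂ y) * f 0 y) := by
    refine integral_congr_ae (Eventually.of_forall fun y => ?_)
    simp only [smul_eq_mul]; ring
  rw [e5, e2]
  simp only [smul_eq_mul]
  ring

end

section

variable {n : ℕ}

/-! ### The weight `ρ` and quadratic polynomials -/

theorem rho_eq_mul_exp (y : Eucl n) :
    rho y = (4 * Real.pi) ^ (-(n : ℝ) / 2) * Real.exp (-(1 / 4) * ‖y‖ ^ 2) := by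
  rw [rho, show -(1 / 4) * ‖y‖ ^ 2 = -‖y‖ ^ 2 / 4 by ring]

theorem contDiff_rho : ContDiff ℝ ∞ (rho : Eucl n → ℝ) := by
  rw [funext rho_eq_mul_exp]
  exact contDiff_const.mul (contDiff_gaussian _)

theorem rho_pos (y : Eucl n) : 0 < rho y := by
  unfold rho; positivity

theorem fderiv_rho (y v : Eucl n) : fderiv ℝ rho y v = rho y * (-(1 / 2) * inner ℝ y v) := by
  rw [funext rho_eq_mul_exp,
    fderiv_const_mul ((contDiff_gaussian _).differentiable (by simp) y), _root_.smul_apply,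
    fderiv_gaussian, smul_eq_mul]
  ring

theorem GaussIntegrable.integrable_rho_smul {E : Type*} [NormedAddCommGroup E] [NormedSpace ℝ E]
    {f : Eucl n → E} (hf : GaussIntegrable f) : Integrable fun y => rho y • f y := by
  simp_rw [rho_eq_mul_exp, mul_smul]
  exact (hf (1 / 4) (by norm_num)).smul ((4 * Real.pi) ^ (-(n : ℝ) / 2) : ℝ)

/-- The divergence theorem for the weight `ρ`. -/
theorem integral_mul_rho_eq_zero {Z : Eucl n → Eucl n} {D : Eucl n → ℝ} (hZ : ContDiff ℝ 1 Z)
    (gZ : GaussIntegrable Z) (gD : GaussIntegrable D)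
    (h : ∀ y, divg Z y - 1 / 2 * inner ℝ y (Z y) = D y) : ∫ y, D y * rho y = 0 := by
  have h1 : ∀ y, divg (fun y => rho y • Z y) y = D y * rho y := fun y => by
    rw [divg_smul (contDiff_rho.differentiable (by simp) y) (hZ.differentiable (by norm_num) y),
      fderiv_rho, ← h]
    ring
  have h2 := integral_divg_eq_zero (Z := fun y => rho y • Z y)
    ((contDiff_rho.of_le (by exact_mod_cast le_top)).smul hZ) gZ.integrable_rho_smul
    (by rw [funext h1]; exact gD.integrable_mul_rho)
  simpa only [h1] using h2

/-- The quadratic polynomial `c₁ v·y + c₂ |y|² + c₃`. -/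
noncomputable def quadPoly (v : Eucl n) (c₁ c₂ c₃ : ℝ) (y : Eucl n) : ℝ :=
  c₁ * inner ℝ v y + c₂ * ‖y‖ ^ 2 + c₃

theorem contDiff_quadPoly (v : Eucl n) (c₁ c₂ c₃ : ℝ) : ContDiff ℝ ∞ (quadPoly v c₁ c₂ c₃) :=
  ((contDiff_const.mul (contDiff_const.inner ℝ contDiff_id)).add
    (contDiff_const.mul (contDiff_norm_sq ℝ))).add contDiff_const

theorem differentiableAt_quadPoly (v : Eucl n) (c₁ c₂ c₃ : ℝ) (y : Eucl n) :
    DifferentiableAt ℝ (quadPoly v c₁ c₂ c₃) y :=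
  (contDiff_quadPoly v c₁ c₂ c₃).differentiable (by simp) y

theorem fderiv_quadPoly (v : Eucl n) (c₁ c₂ c₃ : ℝ) (y u : Eucl n) :
    fderiv ℝ (quadPoly v c₁ c₂ c₃) y u = c₁ * inner ℝ v u + c₂ * (2 * inner ℝ y u) := by
  have h1 : HasFDerivAt (fun y : Eucl n => c₁ * inner ℝ v y) (c₁ • innerSL ℝ v) y :=
    (innerSL ℝ v).hasFDerivAt.const_mul c₁
  have h2 : HasFDerivAt (fun y : Eucl n => c₂ * ‖y‖ ^ 2) (c₂ • (2 • innerSL ℝ y)) y :=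
    (hasStrictFDerivAt_norm_sq y).hasFDerivAt.const_mul _
  have h3 : HasFDerivAt (quadPoly v c₁ c₂ c₃) _ y := (h1.fun_add h2).add_const c₃
  rw [h3.fderiv]
  simp

theorem hasGrowth_quadPoly (w : Eucl n → ℝ) (v : Eucl n) (c₁ c₂ c₃ : ℝ) :
    HasGrowth w 0 (quadPoly v c₁ c₂ c₃) :=
  ((((HasGrowth.const v).inner HasGrowth.id).const_mul c₁).add
    (HasGrowth.id.norm_sq.const_mul c₂)).add (HasGrowth.const c₃)

/-- The vector field `a(y) v + b(y) y + u`, with quadratic polynomials `a`, `b`. -/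
noncomputable def polyField (v u : Eucl n) (a₁ a₂ a₃ b₁ b₂ b₃ : ℝ) (y : Eucl n) : Eucl n :=
  quadPoly v a₁ a₂ a₃ y • v + quadPoly v b₁ b₂ b₃ y • y + u

section PolyField

variable (v u : Eucl n) (a₁ a₂ a₃ b₁ b₂ b₃ : ℝ)

theorem contDiff_polyField : ContDiff ℝ ∞ (polyField v u a₁ a₂ a₃ b₁ b₂ b₃) :=
  (((contDiff_quadPoly _ _ _ _).smul contDiff_const).add
    ((contDiff_quadPoly _ _ _ _).smul contDiff_id)).add contDiff_const

theorem fderiv_polyField (y z : Eucl n) : fderiv ℝ (polyField v u a₁ a₂ a₃ b₁ b₂ b₃) y z =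
    (a₁ * inner ℝ v z + a₂ * (2 * inner ℝ y z)) • v
      + ((b₁ * inner ℝ v z + b₂ * (2 * inner ℝ y z)) • y + quadPoly v b₁ b₂ b₃ y • z) := by
  have h1 := (differentiableAt_quadPoly v a₁ a₂ a₃ y).hasFDerivAt.smul (hasFDerivAt_const v y)
  have h2 := (differentiableAt_quadPoly v b₁ b₂ b₃ y).hasFDerivAt.smul (hasFDerivAt_id y)
  have h3 : HasFDerivAt (polyField v u a₁ a₂ a₃ b₁ b₂ b₃) _ y := (h1.add h2).add_const u
  rw [h3.fderiv]
  simp only [_root_.add_apply, _root_.smul_apply, ContinuousLinearMap.smulRight_apply,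
    fderiv_quadPoly, smul_zero, zero_add, id,
    ContinuousLinearMap.id_apply]
  rw [add_comm (quadPoly v b₁ b₂ b₃ y • z)]

theorem divg_polyField (y : Eucl n) : divg (polyField v u a₁ a₂ a₃ b₁ b₂ b₃) y =
    (a₁ * inner ℝ v v + a₂ * (2 * inner ℝ y v))
      + (n * quadPoly v b₁ b₂ b₃ y + (b₁ * inner ℝ v y + b₂ * (2 * inner ℝ y y))) := by
  have h1 := differentiableAt_quadPoly v a₁ a₂ a₃ y
  have h2 := differentiableAt_quadPoly v b₁ b₂ b₃ y
  unfold polyField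
  rw [divg_add ((h1.fun_smul (differentiableAt_const v)).fun_add (h2.fun_smul differentiableAt_fun_id))
      (differentiableAt_const u),
    divg_add (h1.fun_smul (differentiableAt_const v)) (h2.fun_smul differentiableAt_fun_id),
    divg_smul h1 (differentiableAt_const v), divg_smul h2 differentiableAt_fun_id, divg_const,
    divg_const, divg_id, fderiv_quadPoly, fderiv_quadPoly]
  ring

theorem hasGrowth_polyField (w : Eucl n → ℝ) : HasGrowth w 0 (polyField v u a₁ a₂ a₃ b₁ b₂ b₃) :=
  (((hasGrowth_quadPoly w v a₁ a₂ a₃).smul (HasGrowth.const v)).add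
    ((hasGrowth_quadPoly w v b₁ b₂ b₃).smul HasGrowth.id)).add (HasGrowth.const u)

end PolyField

/-! ### The nonlinearity -/

theorem contDiff_abs_rpow {f : Eucl n → ℝ} (hf : ContDiff ℝ 1 f) {q : ℝ} (hq : 1 < q) :
    ContDiff ℝ 1 fun y => |f y| ^ q := by
  simpa only [Real.norm_eq_abs] using hf.norm_rpow hq

/-- The potential `V(u) = u²/(2(p-1)) - |u|^{p+1}/(p+1)`. -/
noncomputable def potential (p u : ℝ) : ℝ := 1 / (2 * (p - 1)) * u ^ 2 - 1 / (p + 1) * |u| ^ (p + 1)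

/-- The derivative `u/(p-1) - |u|^{p-1}u` of the potential. -/
noncomputable def force (p u : ℝ) : ℝ := 1 / (p - 1) * u - |u| ^ (p - 1) * u

theorem hasDerivAt_abs_rpow_add_one {p : ℝ} (hp : 1 < p) (u : ℝ) :
    HasDerivAt (fun u : ℝ => |u| ^ (p + 1)) ((p + 1) * (|u| ^ (p - 1) * u)) u := by
  have h := hasDerivAt_abs_rpow u (p := p + 1) (by linarith)
  rwa [show p + 1 - 2 = p - 1 by ring, mul_assoc] at h

theorem hasDerivAt_potential {p : ℝ} (hp : 1 < p) (u : ℝ) :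
    HasDerivAt (potential p) (force p u) u := by
  have h := ((hasDerivAt_pow 2 u).const_mul (1 / (2 * (p - 1)))).fun_sub
    ((hasDerivAt_abs_rpow_add_one hp u).const_mul (1 / (p + 1)))
  refine h.congr_deriv ?_
  have h1 : p - 1 ≠ 0 := by linarith
  have h2 : p + 1 ≠ 0 := by linarith
  unfold force
  field_simp
  ring

/-- The derivative of `|u|^{p-1}u`. -/
theorem hasDerivAt_abs_rpow_mul_self {p : ℝ} (hp : 1 < p) (u : ℝ) :
    HasDerivAt (fun u : ℝ => |u| ^ (p - 1) * u) (p * |u| ^ (p - 1)) u := by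
  rcases eq_or_ne u 0 with rfl | hu
  -- At the origin the difference quotient is exactly `|u|^(p-1)`, which tends to zero because `p >
  -- 1`.
  · rw [abs_zero, Real.zero_rpow (by linarith), mul_zero, hasDerivAt_iff_tendsto_slope]
    have h1 : Tendsto (fun u : ℝ => |u| ^ (p - 1)) (𝓝[≠] 0) (𝓝 0) := by
      have : ContinuousAt (fun u : ℝ => |u| ^ (p - 1)) 0 :=
        continuousAt_id.abs.rpow_const (Or.inr (by linarith))
      have h2 := this.tendsto
      rw [abs_zero, Real.zero_rpow (by linarith)] at h2
      exact h2.mono_left nhdsWithin_le_nhds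
    refine h1.congr' ?_
    filter_upwards [self_mem_nhdsWithin] with x hx
    have hx' : x ≠ 0 := hx
    rw [slope_def_field]
    field_simp
    simp
  · have h1 : HasDerivAt (fun u : ℝ => |u| ^ (p - 1))
        ((SignType.sign u : ℝ) * (p - 1) * |u| ^ (p - 1 - 1)) u :=
      (hasDerivAt_abs hu).rpow_const (Or.inl (abs_ne_zero.2 hu))
    refine (h1.fun_mul (hasDerivAt_id' u)).congr_deriv ?_
    rw [Real.rpow_sub_one (abs_ne_zero.2 hu)]
    have h3 : (SignType.sign u : ℝ) * u = |u| := by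
      rw [mul_comm]; exact self_mul_sign u
    have h4 := abs_ne_zero.2 hu
    field_simp
    linear_combination (p - 1) * h3

theorem abs_rpow_add_one {p : ℝ} (hp : 1 < p) (u : ℝ) :
    |u| ^ (p + 1) = |u| ^ (p - 1) * u ^ 2 := by
  rcases eq_or_ne u 0 with rfl | hu
  · rw [abs_zero, Real.zero_rpow (by linarith)]; simp
  · rw [show p + 1 = p - 1 + 2 by ring, Real.rpow_add (abs_pos.2 hu), Real.rpow_two, sq_abs]

/-! ### The divergence identity -/

section Identity

variable {p : ℝ} {w : Eucl n → ℝ}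

theorem IsBoundedSolution.laplacian_eq (hw : IsBoundedSolution p w) (y : Eucl n) :
    Laplacian.laplacian w y = 1 / 2 * inner ℝ y (gradient w y) + force p (w y) := by
  have := hw.equation y
  unfold force
  linarith

theorem contDiff_potential (hp : 1 < p) (hw : ContDiff ℝ 2 w) :
    ContDiff ℝ 1 fun y => potential p (w y) :=
  (contDiff_const.mul ((hw.of_le (by norm_num)).pow 2)).sub
    (contDiff_const.mul (contDiff_abs_rpow (hw.of_le (by norm_num)) (by linarith)))

/-- The vector field whose weighted divergence produces the second variation identity. -/
noncomputable def noetherField (p : ℝ) (w φ ζ θ : Eucl n → ℝ) (X Y : Eucl n → Eucl n)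
    (y : Eucl n) : Eucl n :=
  (inner ℝ (gradient w y) (X y) • gradient w y - (1 / 2 * ‖gradient w y‖ ^ 2) • X y)
    - potential p (w y) • X y
    + (ζ y * w y) • gradient w y + (w y ^ 2) • Y y + (2 * (θ y * φ y)) • gradient w y

/-- Second derivatives of `w` occur only as `Δw`, which the equation turns into `½ y·∇w + force`.
The drift part cancels against the `-½ y·Z` coming from the weight, and in the `X` terms the force
cancels against the derivative of the potential. What is left involves only first derivatives of
`w`. -/
theorem divg_noetherField (hp : 1 < p) (hw : IsBoundedSolution p w) {φ ζ θ : Eucl n → ℝ}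
    {X Y : Eucl n → Eucl n} {y : Eucl n} (hφ : DifferentiableAt ℝ φ y)
    (hζ : DifferentiableAt ℝ ζ y) (hθ : DifferentiableAt ℝ θ y) (hX : DifferentiableAt ℝ X y)
    (hY : DifferentiableAt ℝ Y y) :
    divg (noetherField p w φ ζ θ X Y) y - 1 / 2 * inner ℝ y (noetherField p w φ ζ θ X Y y) =
      inner ℝ (gradient w y) (fderiv ℝ X y (gradient w y))
      - (1 / 2 * ‖gradient w y‖ ^ 2 + potential p (w y)) * (divg X y - 1 / 2 * inner ℝ y (X y))
      + ζ y * (w y * force p (w y) + ‖gradient w y‖ ^ 2) + w y * fderiv ℝ ζ y (gradient w y)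
      + 2 * w y * inner ℝ (gradient w y) (Y y) + w y ^ 2 * (divg Y y - 1 / 2 * inner ℝ y (Y y))
      + 2 * (θ y * φ y * force p (w y) + θ y * inner ℝ (gradient w y) (gradient φ y)
        + φ y * fderiv ℝ θ y (gradient w y)) := by
  have dw : DifferentiableAt ℝ w y := hw.contDiff.differentiable (by norm_num) y
  have dg : DifferentiableAt ℝ (gradient w) y :=
    (contDiff_gradient hw.contDiff).differentiable (by norm_num) y
  have dV : HasFDerivAt (fun y => potential p (w y)) (force p (w y) • fderiv ℝ w y) y :=
    (hasDerivAt_potential hp (w y)).comp_hasFDerivAt y dw.hasFDerivAt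
  have d1 : DifferentiableAt ℝ (fun y => inner ℝ (gradient w y) (X y) • gradient w y
      - (1 / 2 * ‖gradient w y‖ ^ 2) • X y) y :=
    ((dg.inner ℝ hX).fun_smul dg).fun_sub (((dg.norm_sq ℝ).const_mul _).fun_smul hX)
  have d2 : DifferentiableAt ℝ (fun y => potential p (w y) • X y) y :=
    dV.differentiableAt.fun_smul hX
  have d3 : DifferentiableAt ℝ (fun y => (ζ y * w y) • gradient w y) y :=
    (hζ.fun_mul dw).fun_smul dg
  have d4 : DifferentiableAt ℝ (fun y => (w y ^ 2) • Y y) y := (dw.fun_pow 2).fun_smul hY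
  have d5 : DifferentiableAt ℝ (fun y => (2 * (θ y * φ y)) • gradient w y) y :=
    ((hθ.fun_mul hφ).const_mul 2).fun_smul dg
  have e1 : ∀ {f : Eucl n → ℝ} {u : Eucl n}, fderiv ℝ f y u = inner ℝ (gradient f y) u :=
    inner_gradient_left.symm
  unfold noetherField
  rw [divg_add (((d1.fun_sub d2).fun_add d3).fun_add d4) d5, divg_add ((d1.fun_sub d2).fun_add d3) d4,
    divg_add (d1.fun_sub d2) d3, divg_sub d1 d2, divg_stress hw.contDiff hX,
    divg_smul dV.differentiableAt hX, divg_smul (hζ.fun_mul dw) dg, divg_smul (dw.fun_pow 2) hY,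
    divg_smul ((hθ.fun_mul hφ).const_mul 2) dg, divg_gradient hw.contDiff, dV.fderiv,
    fderiv_fun_mul hζ dw, fderiv_fun_pow 2 dw, fderiv_const_mul (hθ.fun_mul hφ),
    fderiv_fun_mul hθ hφ, hw.laplacian_eq]
  simp only [inner_add_right, inner_sub_right, real_inner_smul_right, _root_.add_apply,
    _root_.smul_apply, smul_eq_mul, nsmul_eq_mul]
  simp only [e1, real_inner_self_eq_norm_sq, real_inner_comm (gradient w y) (gradient φ y)]
  push_cast
  ring

theorem contDiff_noetherField (hp : 1 < p) (hw : ContDiff ℝ 2 w) {φ ζ θ : Eucl n → ℝ}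
    {X Y : Eucl n → Eucl n} (hφ : ContDiff ℝ 1 φ) (hζ : ContDiff ℝ 1 ζ) (hθ : ContDiff ℝ 1 θ)
    (hX : ContDiff ℝ 1 X) (hY : ContDiff ℝ 1 Y) : ContDiff ℝ 1 (noetherField p w φ ζ θ X Y) := by
  have hg := contDiff_gradient hw
  have hw1 : ContDiff ℝ 1 w := hw.of_le (by norm_num)
  exact (((((hg.inner ℝ hX).smul hg).sub ((contDiff_const.mul (hg.norm_sq ℝ)).smul hX)).sub
    ((contDiff_potential hp hw).smul hX)).add ((hζ.mul hw1).smul hg)).add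
    ((hw1.pow 2).smul hY) |>.add ((contDiff_const.mul (hθ.mul hφ)).smul hg)

end Identity

end

/-! ### The two densities and the pointwise identity between them. -/

section

variable {n : ℕ} {p : ℝ} {w φ : Eucl n → ℝ}

/-- The integrand (against `ρ`) of the second derivative of the functional, as obtained by
differentiating twice under the integral sign. -/
noncomputable def secondDensity (p : ℝ) (w φ : Eucl n → ℝ) (θ θ' η η' : Eucl n → ℝ)
    (y : Eucl n) : ℝ :=
  1 / 2 * (2 * ‖gradient φ y‖ ^ 2 + 2 * θ y * (2 * inner ℝ (gradient w y) (gradient φ y))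
      + (θ' y + θ y ^ 2) * ‖gradient w y‖ ^ 2)
    - 1 / (p + 1) * ((p + 1) * (p * |w y| ^ (p - 1) * φ y * φ y)
      + 2 * θ y * ((p + 1) * (|w y| ^ (p - 1) * w y * φ y))
      + (θ' y + θ y ^ 2) * |w y| ^ (p + 1))
    + 1 / (2 * (p - 1)) * (2 * φ y ^ 2 + 2 * η y * (2 * w y * φ y)
      + (η' y + η y ^ 2) * w y ^ 2)

/-- The integrand (against `ρ`) of the second variation formula. -/
noncomputable def variationDensity (p : ℝ) (w φ : Eucl n → ℝ) (y₀ : Eucl n) (h : ℝ)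
    (y : Eucl n) : ℝ :=
  ‖gradient φ y‖ ^ 2 + 1 / (p - 1) * φ y ^ 2 - p * (|w y| ^ (p - 1) * φ y ^ 2)
    + h * (Lam p w y * φ y) - φ y * inner ℝ (gradient w y) y₀
    - 1 / 2 * inner ℝ (gradient w y) y₀ ^ 2
    - h ^ 2 * (1 / (p - 1) * w y + 1 / 2 * inner ℝ y (gradient w y)) ^ 2

/-- The field `2θφ∇w` accounts for the terms linear in `φ`; the `Λ(w)φ` term arises because the mass
integral has the smaller exponent, so `η = θ + h`. In `X`, the parts `½(y₀·y)y₀` and `(h²/8)|y|²y`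
produce the squares `½(∇w·y₀)²` and `¼h²(y·∇w)²` through the Jacobian, while `(h/2)|y|²y₀` and
`-h(y₀·y)y` are paired so that no product `(y₀·∇w)(y·∇w)` is left. The remaining coefficients make
the other monomials in `y₀`, `y₀'`, `h`, `h'` match. -/
theorem secondDensity_sub_variationDensity (hp : 1 < p) (hw : IsBoundedSolution p w)
    (hφ : Differentiable ℝ φ) (y₀ y₀' : Eucl n) (h h' : ℝ) (y : Eucl n) {k : ℝ}
    (hk : k = 1 / (p - 1)) {β : ℝ} (hβ : β = 1 + 2 * k - n / 2) :
    let Z := noetherField p w φ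
      (quadPoly y₀ (-2 * h * k) (h ^ 2 * k / 4) (-h' * k + h ^ 2 * k * (2 * k - n / 2)))
      (quadPoly y₀ (1 / 2) (-h / 4) (-β * h))
      (polyField y₀ y₀' (1 / 2) (h / 2) (h * (4 + 4 * k - n)) (-h) (h ^ 2 / 8)
        (h ^ 2 * (k - n / 4) - h' / 2))
      (polyField y₀ 0 0 0 (h * k) 0 0 (h ^ 2 * k / 4))
    divg Z y - 1 / 2 * inner ℝ y (Z y) =
      secondDensity p w φ (quadPoly y₀ (1 / 2) (-h / 4) (-β * h))
        (fun y => h * inner ℝ y₀ y + 1 / 2 * inner ℝ y₀' y - (h' / 4 + h ^ 2 / 2) * ‖y‖ ^ 2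
          - β * (h' + h ^ 2) - 1 / 2 * ‖y₀‖ ^ 2)
        (quadPoly y₀ (1 / 2) (-h / 4) (-(β - 1) * h))
        (fun y => h * inner ℝ y₀ y + 1 / 2 * inner ℝ y₀' y - (h' / 4 + h ^ 2 / 2) * ‖y‖ ^ 2
          - (β - 1) * (h' + h ^ 2) - 1 / 2 * ‖y₀‖ ^ 2) y
      - variationDensity p w φ y₀ h y := by
  intro Z
  simp only [Z]
  rw [divg_noetherField hp hw (hφ y) (differentiableAt_quadPoly _ _ _ _ _)
    (differentiableAt_quadPoly _ _ _ _ _)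
    ((contDiff_polyField _ _ _ _ _ _ _ _).differentiable (by simp) y)
    ((contDiff_polyField _ _ _ _ _ _ _ _).differentiable (by simp) y)]
  rw [divg_polyField, divg_polyField, fderiv_polyField, fderiv_quadPoly, fderiv_quadPoly]
  unfold secondDensity variationDensity Lam potential force polyField quadPoly
  rw [abs_rpow_add_one hp]
  simp only [inner_add_right, real_inner_smul_right, real_inner_self_eq_norm_sq, inner_zero_right]
  rw [real_inner_comm y₀ y, real_inner_comm y₀' y, real_inner_comm y₀ (gradient w y),
    real_inner_comm (gradient w y) y]
  obtain ⟨l, hl⟩ : ∃ l, l = 1 / (p + 1) := ⟨_, rfl⟩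
  have hk2 : 1 / (2 * (p - 1)) = k / 2 := by rw [hk]; field_simp
  have h1 : p - 1 ≠ 0 := by linarith
  have h2 : p + 1 ≠ 0 := by linarith
  have hlp : l * (p + 1) = 1 := by rw [hl]; field_simp
  have hlk : l * (1 + 2 * k) = k := by
    rw [hl, hk]; field_simp; ring
  have h2k : 2 / (p - 1) = 2 * k := by rw [hk]; ring
  rw [hk2, h2k, ← hk, ← hl, hβ]
  -- All scalar quantities become independent symbols: the identity is polynomial modulo `l(p+1) =
  -- 1` and `l(1+2k) = k`, where `k = 1/(p-1)` and `l = 1/(p+1)`.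
  generalize inner ℝ y₀ y = m
  generalize inner ℝ y₀' y = m'
  generalize inner ℝ y (gradient w y) = C
  generalize inner ℝ y₀ (gradient w y) = B
  generalize inner ℝ (gradient w y) y₀' = B'
  generalize inner ℝ (gradient w y) (gradient φ y) = q
  generalize ‖y‖ ^ 2 = r
  generalize ‖y₀‖ ^ 2 = vv
  generalize ‖gradient w y‖ ^ 2 = A
  generalize ‖gradient φ y‖ ^ 2 = N
  generalize |w y| ^ (p - 1) = g
  generalize w y = u
  generalize φ y = f
  generalize (n : ℝ) = N'
  linear_combination (g * u ^ 2) * (-h' - 2 * h * m + h ^ 2 * ((2 * k - N' / 2) + r / 4)) * hlk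
    + g * f * (p * f + u * (m - h * (r / 2 + 4 * k - N' + 2))) * hlp

end

/-! ### Growth of the densities and the integrated identity. -/

section

variable {n : ℕ} {p : ℝ} {w φ : Eucl n → ℝ}

namespace IsBoundedSolution

theorem hasGrowth_self (hw : IsBoundedSolution p w) : HasGrowth w 0 w :=
  let ⟨_, hM⟩ := hw.bounded
  HasGrowth.of_bounded hw.contDiff.continuous hM

theorem hasGrowth_abs_rpow (hw : IsBoundedSolution p w) {q : ℝ} (hq : 0 ≤ q) :
    HasGrowth w 0 fun y => |w y| ^ q := by
  obtain ⟨M, hM⟩ := hw.bounded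
  refine HasGrowth.of_bounded (C := M ^ q)
    (hw.contDiff.continuous.abs.rpow_const fun _ => Or.inr hq) fun y => ?_
  rw [Real.norm_of_nonneg (Real.rpow_nonneg (abs_nonneg _) _)]
  exact Real.rpow_le_rpow (abs_nonneg _) (hM y) hq

theorem hasGrowth_gradient (hw : IsBoundedSolution p w) : HasGrowth w 1 (gradient w) :=
  HasGrowth.gradient_self hw.contDiff

/-- The equation bounds `Δw` by a constant depending on `sup |w|` plus the drift `½|y||∇w|`, as the
Caccioppoli estimate requires. -/
theorem gaussIntegrable_gradient (hw : IsBoundedSolution p w) (hp : 1 < p) :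
    GaussIntegrable fun y => ‖gradient w y‖ ^ 2 := by
  obtain ⟨M, hM⟩ := hw.bounded
  have hM0 : 0 ≤ M := (abs_nonneg _).trans (hM 0)
  refine gaussIntegrable_norm_gradient_sq hw.contDiff (K := 1 / (p - 1) * M + M ^ (p - 1) * M) hM
    fun y => ?_
  rw [hw.laplacian_eq, force]
  have h1 : |1 / (p - 1) * w y| ≤ 1 / (p - 1) * M := by
    have : 0 ≤ 1 / (p - 1) := one_div_nonneg.2 (by linarith)
    rw [abs_mul, abs_of_nonneg this]
    exact mul_le_mul_of_nonneg_left (hM y) this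
  have h2 : |(|w y| ^ (p - 1) * w y)| ≤ M ^ (p - 1) * M := by
    rw [abs_mul, abs_of_nonneg (Real.rpow_nonneg (abs_nonneg _) _)]
    exact mul_le_mul (Real.rpow_le_rpow (abs_nonneg _) (hM y) (by linarith)) (hM y)
      (abs_nonneg _) (Real.rpow_nonneg hM0 _)
  have h3 := abs_real_inner_le_norm y (gradient w y)
  have h4 : 0 ≤ ‖y‖ * ‖gradient w y‖ := by positivity
  rw [abs_le] at *
  constructor <;> linarith [h1.1, h1.2, h2.1, h2.2, h3.1, h3.2]

theorem hasGrowth_potential (hw : IsBoundedSolution p w) (hp : 1 < p) :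
    HasGrowth w 0 fun y => potential p (w y) :=
  (hw.hasGrowth_self.sq.const_mul _).sub ((hw.hasGrowth_abs_rpow (by linarith)).const_mul _)

theorem hasGrowth_noetherField (hw : IsBoundedSolution p w) (hp : 1 < p) {ζ θ : Eucl n → ℝ}
    {X Y : Eucl n → Eucl n} (gφ : HasGrowth w 0 φ) (gζ : HasGrowth w 0 ζ) (gθ : HasGrowth w 0 θ)
    (gX : HasGrowth w 0 X) (gY : HasGrowth w 0 Y) :
    HasGrowth w 2 (noetherField p w φ ζ θ X Y) :=
  have gg := hw.hasGrowth_gradient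
  ((((((gg.inner gX).smul gg).sub ((gg.norm_sq.const_mul _).smul gX)).sub
    ((hw.hasGrowth_potential hp).smul gX)).add ((gζ.mul hw.hasGrowth_self).smul gg)).add
    (hw.hasGrowth_self.sq.smul gY)).add (((gθ.mul gφ).const_mul 2).smul gg)

theorem hasGrowth_secondDensity (hw : IsBoundedSolution p w) (hp : 1 < p)
    {θ θ' η η' : Eucl n → ℝ} (gφ : HasGrowth w 0 φ) (gdφ : HasGrowth w 0 (gradient φ))
    (gθ : HasGrowth w 0 θ) (gθ' : HasGrowth w 0 θ') (gη : HasGrowth w 0 η)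
    (gη' : HasGrowth w 0 η') : HasGrowth w 2 (secondDensity p w φ θ θ' η η') :=
  have gg := hw.hasGrowth_gradient
  have gw := hw.hasGrowth_self
  have g1 := hw.hasGrowth_abs_rpow (q := p - 1) (by linarith)
  have g2 := hw.hasGrowth_abs_rpow (q := p + 1) (by linarith)
  ((((((gdφ.norm_sq.const_mul 2).add ((gθ.const_mul 2).mul ((gg.inner gdφ).const_mul 2))).add
      ((gθ'.add gθ.sq).mul gg.norm_sq)).const_mul (1 / 2)).sub
    ((((((((g1.const_mul p).mul gφ).mul gφ).const_mul (p + 1)).add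
      ((gθ.const_mul 2).mul (((g1.mul gw).mul gφ).const_mul (p + 1)))).add
      ((gθ'.add gθ.sq).mul g2))).const_mul (1 / (p + 1)))).add
    ((((gφ.sq.const_mul 2).add ((gη.const_mul 2).mul ((gw.const_mul 2).mul gφ))).add
      ((gη'.add gη.sq).mul gw.sq)).const_mul (1 / (2 * (p - 1)))))

theorem hasGrowth_lam (hw : IsBoundedSolution p w) : HasGrowth w 1 (Lam p w) :=
  (hw.hasGrowth_self.const_mul (2 / (p - 1))).add (HasGrowth.id.inner hw.hasGrowth_gradient)

theorem hasGrowth_inner_gradient (hw : IsBoundedSolution p w) (v : Eucl n) :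
    HasGrowth w 1 fun y => inner ℝ (gradient w y) v :=
  hw.hasGrowth_gradient.inner (HasGrowth.const v)

theorem hasGrowth_dilation (hw : IsBoundedSolution p w) :
    HasGrowth w 1 fun y => 1 / (p - 1) * w y + 1 / 2 * inner ℝ y (gradient w y) :=
  (hw.hasGrowth_self.const_mul _).add ((HasGrowth.id.inner hw.hasGrowth_gradient).const_mul _)

/-- The variation density integrates to the second variation formula. -/
theorem integral_variationDensity (hw : IsBoundedSolution p w) (hp : 1 < p)
    (gφ : HasGrowth w 0 φ) (gdφ : HasGrowth w 0 (gradient φ)) (y₀ : Eucl n) (h : ℝ) :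
    GaussIntegrable (variationDensity p w φ y₀ h) ∧
    ∫ y, variationDensity p w φ y₀ h y * rho y = quadQ p w φ
        + h * (∫ y, Lam p w y * φ y * rho y)
        - (∫ y, φ y * inner ℝ (gradient w y) y₀ * rho y)
        - 1 / 2 * (∫ y, (inner ℝ (gradient w y) y₀) ^ 2 * rho y)
        - h ^ 2 * (∫ y, (1 / (p - 1) * w y + 1 / 2 * inner ℝ y (gradient w y)) ^ 2 * rho y) := by
  have G := hw.gaussIntegrable_gradient hp
  have g1 := gdφ.norm_sq
  have g2 := gφ.sq.const_mul (1 / (p - 1))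
  have g3 := ((hw.hasGrowth_abs_rpow (q := p - 1) (by linarith)).mul gφ.sq).const_mul p
  have g4 := (hw.hasGrowth_lam.mul gφ).const_mul h
  have g5 := gφ.mul (hw.hasGrowth_inner_gradient y₀)
  have g6 := (hw.hasGrowth_inner_gradient y₀).sq.const_mul (1 / 2)
  have g7 := hw.hasGrowth_dilation.sq.const_mul (h ^ 2)
  have gD : HasGrowth w 2 (variationDensity p w φ y₀ h) :=
    (((((g1.add g2).sub g3).add g4).sub g5).sub g6).sub g7
  refine ⟨gD.gaussIntegrable le_rfl G, ?_⟩
  have i1 := (g1.gaussIntegrable (by norm_num) G).integrable_mul_rho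
  have i2 := (g2.gaussIntegrable (by norm_num) G).integrable_mul_rho
  have i3 := (g3.gaussIntegrable (by norm_num) G).integrable_mul_rho
  have i4 := (g4.gaussIntegrable (by norm_num) G).integrable_mul_rho
  have i5 := (g5.gaussIntegrable (by norm_num) G).integrable_mul_rho
  have i6 := (g6.gaussIntegrable (by norm_num) G).integrable_mul_rho
  have i7 := (g7.gaussIntegrable (by norm_num) G).integrable_mul_rho
  unfold quadQ
  simp only [← integral_const_mul, ← mul_assoc]
  simp only [mul_assoc] at i1 i2 i3 i4 i5 i6 i7
  simp only [mul_assoc]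
  have j2 := i1.fun_add i2
  have j3 := integrable_fun_sub j2 i3
  have j4 := j3.fun_add i4
  have j5 := integrable_fun_sub j4 i5
  rw [← integral_add i1 i2, ← integral_sub j2 i3, ← integral_add j3 i4, ← integral_sub j4 i5,
    ← integral_sub j5 i6, ← integral_sub (integrable_fun_sub j5 i6) i7]
  refine integral_congr_ae (Eventually.of_forall fun y => ?_)
  simp only [variationDensity]
  ring

/-- The second derivative obtained by differentiating under the integral sign agrees with the
second variation formula. -/
theorem integral_secondDensity (hw : IsBoundedSolution p w) (hp : 1 < p) (hφ : ContDiff ℝ 1 φ)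
    (gφ : HasGrowth w 0 φ) (gdφ : HasGrowth w 0 (gradient φ)) (y₀ y₀' : Eucl n) (h h' : ℝ)
    {β : ℝ} (hβ : β = 1 + 2 * (1 / (p - 1)) - n / 2) {θ θ' η η' : Eucl n → ℝ}
    (hθ : ∀ y, θ y = quadPoly y₀ (1 / 2) (-h / 4) (-β * h) y)
    (hθ' : ∀ y, θ' y = h * inner ℝ y₀ y + 1 / 2 * inner ℝ y₀' y - (h' / 4 + h ^ 2 / 2) * ‖y‖ ^ 2
      - β * (h' + h ^ 2) - 1 / 2 * ‖y₀‖ ^ 2)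
    (hη : ∀ y, η y = quadPoly y₀ (1 / 2) (-h / 4) (-(β - 1) * h) y)
    (hη' : ∀ y, η' y = h * inner ℝ y₀ y + 1 / 2 * inner ℝ y₀' y - (h' / 4 + h ^ 2 / 2) * ‖y‖ ^ 2
      - (β - 1) * (h' + h ^ 2) - 1 / 2 * ‖y₀‖ ^ 2) :
    ∫ y, secondDensity p w φ θ θ' η η' y * rho y =
      ∫ y, variationDensity p w φ y₀ h y * rho y := by
  have G := hw.gaussIntegrable_gradient hp
  have gq : ∀ c : ℝ, HasGrowth w 0 fun y : Eucl n => h * inner ℝ y₀ y + 1 / 2 * inner ℝ y₀' y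
      - (h' / 4 + h ^ 2 / 2) * ‖y‖ ^ 2 - c - 1 / 2 * ‖y₀‖ ^ 2 := fun c =>
    ((((((HasGrowth.const y₀).inner HasGrowth.id).const_mul h).add
      (((HasGrowth.const y₀').inner HasGrowth.id).const_mul (1 / 2))).sub
      (HasGrowth.id.norm_sq.const_mul _)).sub (HasGrowth.const c)).sub (HasGrowth.const _)
  obtain rfl := funext hθ
  obtain rfl := funext hθ'
  obtain rfl := funext hη
  obtain rfl := funext hη'
  have g1 := (hw.hasGrowth_secondDensity hp gφ gdφ (hasGrowth_quadPoly w y₀ (1 / 2) (-h / 4)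
    (-β * h)) (gq (β * (h' + h ^ 2))) (hasGrowth_quadPoly w y₀ (1 / 2) (-h / 4) (-(β - 1) * h))
    (gq ((β - 1) * (h' + h ^ 2)))).gaussIntegrable le_rfl G
  have g2 := (hw.integral_variationDensity hp gφ gdφ y₀ h).1
  have hq := fun v c₁ c₂ c₃ => (contDiff_quadPoly (n := n) v c₁ c₂ c₃).of_le
    (m := 1) (by exact_mod_cast le_top)
  have hf := fun v u a₁ a₂ a₃ b₁ b₂ b₃ => (contDiff_polyField (n := n) v u a₁ a₂ a₃ b₁ b₂ b₃).of_le
    (m := 1) (by exact_mod_cast le_top)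
  -- The field and both densities have degree at most two in `∇w`, so the weighted divergence
  -- theorem applies without boundary terms.
  have key := integral_mul_rho_eq_zero
    (contDiff_noetherField hp hw.contDiff hφ (hq _ _ _ _) (hq _ _ _ _)
      (hf _ _ _ _ _ _ _ _) (hf _ _ _ _ _ _ _ _))
    ((hw.hasGrowth_noetherField hp gφ (hasGrowth_quadPoly w _ _ _ _) (hasGrowth_quadPoly w _ _ _ _)
      (hasGrowth_polyField _ _ _ _ _ _ _ _ w) (hasGrowth_polyField _ _ _ _ _ _ _ _ w)).gaussIntegrable
      le_rfl G) (g1.sub g2)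
    (secondDensity_sub_variationDensity hp hw (hφ.differentiable (by norm_num)) y₀ y₀' h h' · rfl hβ)
  rw [← sub_eq_zero, ← integral_sub g1.integrable_mul_rho g2.integrable_mul_rho, ← key]
  simp only [← sub_mul]

end IsBoundedSolution

end

section

variable {n : ℕ} {p : ℝ} {w φ : Eucl n → ℝ}

/-! ### The heat kernel as a Gaussian weight -/

/-- The coefficient `κ` for which `(-t)^α G(y - x, t)` is `gaussWeight κ τ b`. -/
noncomputable def heatKappa (α : ℝ) (x : ℝ → Eucl n) (t : ℝ → ℝ) (s : ℝ) : ℝ :=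
  (α - n / 2) * Real.log (-t s) + 1 / (4 * t s) * ‖x s‖ ^ 2 + -(n / 2) * Real.log (4 * Real.pi)

/-- Expanding `|y - x|²/(4t)` gives the quadratic, linear and constant parts; the powers of `-t` and
`4π` join the exponent through logarithms. -/
theorem rpow_mul_heatKernel (α : ℝ) (x : ℝ → Eucl n) (t : ℝ → ℝ) {s : ℝ} (ht : t s < 0)
    (y : Eucl n) : (-t s) ^ α * heatKernel (y - x s) (t s) =
      gaussWeight (heatKappa α x t) (fun s => 1 / (4 * t s)) (fun s => (-1 / (2 * t s)) • x s) s y := by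
  have h1 : 0 < -t s := by linarith
  have h2 : (4 * Real.pi) ≠ 0 := by positivity
  have h3 : -4 * Real.pi * t s = 4 * Real.pi * (-t s) := by ring
  have h4 : t s ≠ 0 := ht.ne
  rw [heatKernel, h3, Real.rpow_def_of_pos h1, Real.rpow_def_of_pos (by positivity),
    Real.log_mul h2 h1.ne', ← Real.exp_add, ← Real.exp_add, gaussWeight, heatKappa,
    norm_sub_sq_real, real_inner_smul_left, real_inner_comm (x s) y]
  congr 1
  field_simp
  ring

namespace IsVariation

theorem congr_values {V : Type*} [NormedAddCommGroup V] [NormedSpace ℝ V] {c : ℝ → V}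
    {a v v' b u u' : V} (h : IsVariation c a v v') (ha : a = b) (hv : v = u) (hv' : v' = u') :
    IsVariation c b u u' := by
  subst ha hv hv'; exact h

variable {x : ℝ → Eucl n} {t : ℝ → ℝ} {y₀ y₀' : Eucl n} {h h' : ℝ}

theorem log_neg (ht : IsVariation t (-1) h h') :
    IsVariation (fun s => Real.log (-t s)) 0 (-h) (-h' - h ^ 2) := by
  have h1 : ∀ᶠ z in 𝓝 (-1 : ℝ), HasDerivAt (fun z : ℝ => Real.log (-z)) z⁻¹ z := by
    filter_upwards [eventually_ne_nhds (by norm_num : (-1 : ℝ) ≠ 0)] with z hz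
    simpa only [Real.log_neg_eq_log] using Real.hasDerivAt_log hz
  have h2 := ht.comp h1 (hasDerivAt_inv (by norm_num))
  convert h2 using 1 <;> norm_num
  ring

theorem inv_four (ht : IsVariation t (-1) h h') :
    IsVariation (fun s => 1 / (4 * t s)) (-(1 / 4)) (-(h / 4)) (-(h' / 4 + h ^ 2 / 2)) := by
  have h1 : ∀ᶠ z in 𝓝 (-1 : ℝ), HasDerivAt (fun z : ℝ => z⁻¹) (-(z ^ 2)⁻¹) z := by
    filter_upwards [eventually_ne_nhds (by norm_num : (-1 : ℝ) ≠ 0)] with z hz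
    exact hasDerivAt_inv hz
  have h2 : HasDerivAt (fun z : ℝ => -(z ^ 2)⁻¹) (-2) (-1) := by
    have := ((hasDerivAt_pow 2 (-1 : ℝ)).fun_inv (by norm_num)).fun_neg
    refine this.congr_deriv (by norm_num)
  have h3 := (ht.comp h1 h2).const_mul (1 / 4)
  convert h3 using 1
  · funext s; rw [one_div, mul_inv]; norm_num
  · norm_num
  · ring
  · ring

/-- As `x(0) = 0`, the term `|x|²/(4t)` has zero value and first derivative and contributes only
`-½|y₀|²` at second order. -/
theorem heatKappa (α : ℝ) (hx : IsVariation x 0 y₀ y₀') (ht : IsVariation t (-1) h h') :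
    IsVariation (heatKappa α x t) (-(n / 2) * Real.log (4 * Real.pi)) (-(α - n / 2) * h)
      (-(α - n / 2) * (h' + h ^ 2) - 1 / 2 * ‖y₀‖ ^ 2) := by
  have h1 := ((ht.log_neg.const_mul (α - n / 2)).add (ht.inv_four.smul hx.norm_sq)).add
    (const (-(n / 2) * Real.log (4 * Real.pi)))
  refine h1.congr_values ?_ ?_ ?_
  · simp
  · simp only [inner_zero_left, norm_zero, smul_eq_mul]; ring
  · simp only [inner_zero_left, norm_zero, smul_eq_mul]; ring

theorem heatShift (hx : IsVariation x 0 y₀ y₀') (ht : IsVariation t (-1) h h') :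
    IsVariation (fun s => (-1 / (2 * t s)) • x s) 0 ((1 / 2 : ℝ) • y₀)
      (h • y₀ + (1 / 2 : ℝ) • y₀') := by
  have h1 := (ht.inv_four.const_mul (-2)).smul hx
  convert h1 using 1
  · funext s
    congr 1
    rw [show 4 * t s = 2 * (2 * t s) by ring, one_div, mul_inv]
    ring
  · simp
  · rw [smul_zero, add_zero]; norm_num
  · rw [smul_zero, add_zero]; module

end IsVariation

/-! ### The three families of integrands -/

theorem gradient_add_const_mul (hw : Differentiable ℝ w) (hφ : Differentiable ℝ φ) (s : ℝ)
    (y : Eucl n) : gradient (fun y => w y + s * φ y) y = gradient w y + s • gradient φ y := by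
  apply HasGradientAt.gradient
  rw [hasGradientAt_iff_hasFDerivAt, map_add, map_smul, toDual_gradient, toDual_gradient]
  exact (hw y).hasFDerivAt.fun_add ((hφ y).hasFDerivAt.const_mul s)

theorem norm_smul_le_of_mem_Ioo {E : Type*} [NormedAddCommGroup E] [NormedSpace ℝ E] {s : ℝ}
    (hs : s ∈ Set.Ioo (-1 : ℝ) 1) (v : E) : ‖s • v‖ ≤ ‖v‖ := by
  rw [norm_smul]
  exact mul_le_of_le_one_left (norm_nonneg _) (abs_le.2 ⟨hs.1.le, hs.2.le⟩)

/-- The one family whose majorant involves `∇w`, so the Caccioppoli bound is needed; constants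
dominate the other two. -/
theorem dominatedFamily_gradient (hw : ContDiff ℝ 2 w)
    (G : GaussIntegrable fun y => ‖gradient w y‖ ^ 2)
    (gdφ : HasGrowth w 0 (gradient φ)) :
    DominatedFamily (fun s y => ‖gradient w y + s • gradient φ y‖ ^ 2)
      (fun s y => 2 * inner ℝ (gradient w y + s • gradient φ y) (gradient φ y))
      (fun _ y => 2 * ‖gradient φ y‖ ^ 2)
      (fun y => 2 * (‖gradient w y‖ + ‖gradient φ y‖) ^ 2) where
  gauss := HasGrowth.gaussIntegrable
    ((((HasGrowth.gradient_self hw).norm.add gdφ.norm).sq).const_mul 2) (by norm_num) G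
  cont s _ := by
    have h1 := (contDiff_gradient hw).continuous
    have h2 := gdφ.continuous
    refine ⟨?_, ?_, ?_⟩ <;> fun_prop
  bound s hs y := by
    have h1 : ‖gradient w y + s • gradient φ y‖ ≤ ‖gradient w y‖ + ‖gradient φ y‖ :=
      (norm_add_le _ _).trans (by gcongr; exact norm_smul_le_of_mem_Ioo hs _)
    have h0 := norm_nonneg (gradient w y)
    have h0' := norm_nonneg (gradient φ y)
    have h2 := abs_real_inner_le_norm (gradient w y + s • gradient φ y) (gradient φ y)
    have h3 := pow_le_pow_left₀ (norm_nonneg _) h1 2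
    refine ⟨?_, ?_, ?_⟩
    · rw [abs_of_nonneg (by positivity)]
      nlinarith [sq_nonneg (‖gradient w y‖ + ‖gradient φ y‖)]
    · rw [abs_mul, abs_two]
      have h4 := mul_le_mul_of_nonneg_right h1 h0'
      nlinarith
    · rw [abs_of_nonneg (by positivity)]
      have := pow_le_pow_left₀ h0' (by linarith : ‖gradient φ y‖ ≤ ‖gradient w y‖ + ‖gradient φ y‖) 2
      linarith
  deriv s _ y := by
    have h1 : HasDerivAt (fun s : ℝ => gradient w y + s • gradient φ y) (gradient φ y) s := by
      simpa using ((hasDerivAt_id s).smul_const (gradient φ y)).const_add (gradient w y)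
    simpa using h1.norm_sq
  deriv' s _ y := by
    have h1 : HasDerivAt (fun s : ℝ => gradient w y + s • gradient φ y) (gradient φ y) s := by
      simpa using ((hasDerivAt_id s).smul_const (gradient φ y)).const_add (gradient w y)
    have h2 := (h1.inner ℝ (hasDerivAt_const s (gradient φ y))).const_mul 2
    simpa using h2

theorem hasDerivAt_add_mul (a b s : ℝ) : HasDerivAt (fun s : ℝ => a + s * b) b s := by
  simpa using ((hasDerivAt_id s).mul_const b).const_add a

theorem gaussIntegrable_const (c : ℝ) : GaussIntegrable fun _ : Eucl n => c := fun a ha => by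
  simpa using (gaussIntegrable_one a ha).mul_const c

theorem abs_add_mul_le {a b s M N : ℝ} (hs : s ∈ Set.Ioo (-1 : ℝ) 1) (ha : |a| ≤ M)
    (hb : |b| ≤ N) : |a + s * b| ≤ M + N :=
  (abs_add_le _ _).trans (add_le_add ha ((norm_smul_le_of_mem_Ioo hs b).trans hb))

theorem dominatedFamily_sq (hw : Continuous w) (hφ : Continuous φ) {M N : ℝ}
    (hM : ∀ y, |w y| ≤ M) (hN : ∀ y, |φ y| ≤ N) :
    DominatedFamily (fun s y => (w y + s * φ y) ^ 2) (fun s y => 2 * (w y + s * φ y) * φ y)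
      (fun _ y => 2 * φ y ^ 2) (fun _ => 2 * (M + N) ^ 2) where
  gauss := gaussIntegrable_const _
  cont s _ := by refine ⟨?_, ?_, ?_⟩ <;> fun_prop
  bound s hs y := by
    have h1 := abs_add_mul_le hs (hM y) (hN y)
    have hM0 := (abs_nonneg _).trans (hM y)
    have hN0 := (abs_nonneg _).trans (hN y)
    have h2 : |φ y| ≤ M + N := (hN y).trans (by linarith)
    have h3 := mul_le_mul h1 h2 (abs_nonneg _) (by linarith)
    have h4 := pow_le_pow_left₀ (abs_nonneg _) h1 2
    have h5 := pow_le_pow_left₀ (abs_nonneg _) h2 2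
    refine ⟨?_, ?_, ?_⟩
    · rw [abs_pow]; linarith [sq_nonneg (M + N)]
    · rw [abs_mul, abs_mul, abs_two]; linarith
    · rw [abs_mul, abs_two, abs_pow]; linarith
  deriv s _ y := by
    simpa using (hasDerivAt_add_mul (w y) (φ y) s).fun_pow 2
  deriv' s _ y := by
    refine (((hasDerivAt_add_mul (w y) (φ y) s).const_mul 2).mul_const (φ y)).congr_deriv ?_
    ring

/-- Writing `|u|^(p+1) = |u|^(p-1) u²` reduces the function and both derivatives to one estimate,
`key`; the factors `p + 1` and `p` in the majorant cover all three orders. -/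
theorem dominatedFamily_rpow (hp : 1 < p) (hw : Continuous w) (hφ : Continuous φ) {M N : ℝ}
    (hM : ∀ y, |w y| ≤ M) (hN : ∀ y, |φ y| ≤ N) :
    DominatedFamily (fun s y => |w y + s * φ y| ^ (p + 1))
      (fun s y => (p + 1) * (|w y + s * φ y| ^ (p - 1) * (w y + s * φ y) * φ y))
      (fun s y => (p + 1) * (p * |w y + s * φ y| ^ (p - 1) * φ y * φ y))
      (fun _ => (p + 1) * (p * ((M + N) ^ (p - 1) * (M + N) ^ 2))) where
  gauss := gaussIntegrable_const _
  cont s _ := by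
    have h1 : Continuous fun y => |w y + s * φ y| := by fun_prop
    have h2 : Continuous fun y => |w y + s * φ y| ^ (p - 1) :=
      h1.rpow_const fun _ => Or.inr (by linarith)
    have h3 : Continuous fun y => |w y + s * φ y| ^ (p + 1) :=
      h1.rpow_const fun _ => Or.inr (by linarith)
    refine ⟨h3, ?_, ?_⟩ <;> fun_prop
  bound s hs y := by
    have h1 := abs_add_mul_le hs (hM y) (hN y)
    have hM0 := (abs_nonneg _).trans (hM y)
    have hN0 := (abs_nonneg _).trans (hN y)
    have h2 : |φ y| ≤ M + N := (hN y).trans (by linarith)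
    have h3 : |w y + s * φ y| ^ (p - 1) ≤ (M + N) ^ (p - 1) :=
      Real.rpow_le_rpow (abs_nonneg _) h1 (by linarith)
    have h4 : 0 ≤ |w y + s * φ y| ^ (p - 1) := Real.rpow_nonneg (abs_nonneg _) _
    have h5 : 0 ≤ (M + N) ^ (p - 1) := Real.rpow_nonneg (by linarith) _
    have h6 : 0 ≤ (M + N) ^ (p - 1) * (M + N) ^ 2 := by positivity
    have key : ∀ a b : ℝ, |a| ≤ M + N → |b| ≤ M + N →
        |w y + s * φ y| ^ (p - 1) * (|a| * |b|) ≤ (M + N) ^ (p - 1) * (M + N) ^ 2 := by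
      intro a b ha hb
      rw [sq]
      exact mul_le_mul h3 (mul_le_mul ha hb (abs_nonneg _) (by linarith)) (by positivity) h5
    refine ⟨?_, ?_, ?_⟩
    · rw [abs_of_nonneg (Real.rpow_nonneg (abs_nonneg _) _), abs_rpow_add_one hp]
      have h7 := key _ _ h1 h1
      rw [← sq, sq_abs] at h7
      have h8 : (M + N) ^ (p - 1) * (M + N) ^ 2 ≤ p * ((M + N) ^ (p - 1) * (M + N) ^ 2) :=
        le_mul_of_one_le_left h6 hp.le
      have h9 := le_mul_of_one_le_left (h6.trans h8) (by linarith : 1 ≤ p + 1)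
      linarith
    · rw [abs_mul, abs_of_pos (by linarith : 0 < p + 1), abs_mul, abs_mul, abs_of_nonneg h4, mul_assoc]
      refine mul_le_mul_of_nonneg_left ((key _ _ h1 h2).trans ?_) (by linarith)
      exact le_mul_of_one_le_left h6 hp.le
    · rw [abs_mul, abs_of_pos (by linarith : 0 < p + 1), abs_mul, abs_mul, abs_mul,
        abs_of_nonneg h4, abs_of_pos (by linarith : 0 < p), mul_assoc, mul_assoc]
      refine mul_le_mul_of_nonneg_left ?_ (by linarith)
      exact mul_le_mul_of_nonneg_left (key _ _ h2 h2) (by linarith)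
  deriv s _ y := by
    have h1 := (hasDerivAt_abs_rpow_add_one hp (w y + s * φ y)).comp s
      (hasDerivAt_add_mul (w y) (φ y) s)
    refine h1.congr_deriv ?_
    ring
  deriv' s _ y := by
    have h1 := (hasDerivAt_abs_rpow_mul_self hp (w y + s * φ y)).comp s
      (hasDerivAt_add_mul (w y) (φ y) s)
    exact (h1.mul_const (φ y)).const_mul (p + 1)

/-! ### The second variation -/

theorem functionalF_eq (x : ℝ → Eucl n) (t : ℝ → ℝ) {s : ℝ} (ht : t s < 0) (v : Eucl n → ℝ) :
    functionalF p (x s) (t s) v =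
      1 / 2 * (∫ y, gaussWeight (heatKappa ((p + 1) / (p - 1)) x t) (fun s => 1 / (4 * t s))
        (fun s => (-1 / (2 * t s)) • x s) s y * ‖gradient v y‖ ^ 2)
      + -(1 / (p + 1)) * (∫ y, gaussWeight (heatKappa ((p + 1) / (p - 1)) x t)
        (fun s => 1 / (4 * t s)) (fun s => (-1 / (2 * t s)) • x s) s y * |v y| ^ (p + 1))
      + 1 / (2 * (p - 1)) * (∫ y, gaussWeight (heatKappa (2 / (p - 1)) x t)
        (fun s => 1 / (4 * t s)) (fun s => (-1 / (2 * t s)) • x s) s y * v y ^ 2) := by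
  have key : ∀ (α : ℝ) (f : Eucl n → ℝ), ∫ y, gaussWeight (heatKappa α x t)
      (fun s => 1 / (4 * t s)) (fun s => (-1 / (2 * t s)) • x s) s y * f y
      = (-t s) ^ α * ∫ y, f y * heatKernel (y - x s) (t s) := by
    intro α f
    rw [← integral_const_mul]
    refine integral_congr_ae (Eventually.of_forall fun y => ?_)
    simp only
    rw [← rpow_mul_heatKernel α x t ht]
    ring
  rw [key, key, key, functionalF]
  ring

theorem integrable_mul_heatKernel_iff (α : ℝ) (x : ℝ → Eucl n) (t : ℝ → ℝ) {s : ℝ} (ht : t s < 0)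
    (f : Eucl n → ℝ) : Integrable (fun y => gaussWeight (heatKappa α x t)
      (fun s => 1 / (4 * t s)) (fun s => (-1 / (2 * t s)) • x s) s y * f y) ↔
      Integrable fun y => f y * heatKernel (y - x s) (t s) := by
  have h1 : (-t s) ^ α ≠ 0 := (Real.rpow_pos_of_pos (by linarith) _).ne'
  rw [← integrable_const_mul_iff h1.isUnit (fun y => f y * heatKernel (y - x s) (t s))]
  refine integrable_congr (Eventually.of_forall fun y => ?_)
  simp only
  rw [← rpow_mul_heatKernel α x t ht]
  ring

theorem IsBoundedSolution.isVariation_functionalF (hp : 1 < p) (hw : IsBoundedSolution p w)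
    {x : ℝ → Eucl n} {t : ℝ → ℝ} {y₀ y₀' : Eucl n} {h h' : ℝ} (hx : IsVariation x 0 y₀ y₀')
    (ht : IsVariation t (-1) h h') (hφ : ContDiff ℝ ∞ φ) (hφc : HasCompactSupport φ) :
    (∀ᶠ s in 𝓝 (0 : ℝ), FiniteF p (x s) (t s) (fun y => w y + s * φ y)) ∧
    ∃ a v, IsVariation (fun s : ℝ => functionalF p (x s) (t s) (fun y => w y + s * φ y)) a v
      (∫ y, variationDensity p w φ y₀ h y * rho y) := by
  have G := hw.gaussIntegrable_gradient hp
  have dφ : Differentiable ℝ φ := hφ.differentiable (by simp)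
  have dw : Differentiable ℝ w := hw.contDiff.differentiable (by norm_num)
  have gφ : HasGrowth w 0 φ := HasGrowth.of_hasCompactSupport hφ.continuous hφc
  have gdφ := HasGrowth.gradient_of_hasCompactSupport (w := w) hφ hφc
  obtain ⟨M, hM⟩ := hw.bounded
  obtain ⟨N, hN⟩ := hφc.exists_bound_of_continuous hφ.continuous
  have htn : ∀ᶠ s in 𝓝 (0 : ℝ), t s < 0 :=
    ht.hasDerivAt_zero.continuousAt.eventually_lt_const (by rw [ht.value]; norm_num)
  have hτ := ht.inv_four
  have hb := IsVariation.heatShift hx ht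
  -- The gradient and power terms share one time exponent and the mass term has another, hence two
  -- versions of `κ` with common `τ` and `b`.
  have hκ₁ := IsVariation.heatKappa ((p + 1) / (p - 1)) hx ht
  have hκ₂ := IsVariation.heatKappa (2 / (p - 1)) hx ht
  obtain ⟨i1, v1, V1⟩ := (dominatedFamily_gradient hw.contDiff G gdφ).isVariation_integral hκ₁ hτ hb
    (by norm_num)
  obtain ⟨i2, v2, V2⟩ := (dominatedFamily_rpow hp hw.contDiff.continuous hφ.continuous hM
    hN).isVariation_integral hκ₁ hτ hb (by norm_num)
  obtain ⟨i3, v3, V3⟩ := (dominatedFamily_sq hw.contDiff.continuous hφ.continuous hM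
    hN).isVariation_integral hκ₂ hτ hb (by norm_num)
  have hgrad := gradient_add_const_mul dw dφ
  refine ⟨?_, ?_⟩
  · filter_upwards [i1, i2, i3, htn] with s h1 h2 h3 hs
    refine ⟨?_, (integrable_mul_heatKernel_iff _ x t hs _).1 h2,
      (integrable_mul_heatKernel_iff _ x t hs _).1 h3⟩
    simp_rw [hgrad s]
    exact (integrable_mul_heatKernel_iff _ x t hs _).1 h1
  · have hF := ((V1.const_mul (1 / 2)).add (V2.const_mul (-(1 / (p + 1))))).add
      (V3.const_mul (1 / (2 * (p - 1))))
    have hF' := hF.congr (d := fun s => functionalF p (x s) (t s) (fun y => w y + s * φ y)) (by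
      filter_upwards [htn] with s hs
      rw [functionalF_eq x t hs]
      simp_rw [hgrad s])
    refine ⟨_, _, hF'.congr_values rfl rfl ?_⟩
    have hp1 : p - 1 ≠ 0 := by linarith
    have hα : (p + 1) / (p - 1) = 1 + 2 * (1 / (p - 1)) := by field_simp; ring
    -- `θ`, `η` are the first and `θ'`, `η'` the second logarithmic derivatives of the two weights
    -- at `s = 0`, read off from the expansions of `κ`, `τ`, `b`.
    rw [← hw.integral_secondDensity hp (hφ.of_le (by exact_mod_cast le_top)) gφ gdφ y₀ y₀'
      h h' (β := (p + 1) / (p - 1) - n / 2) (by rw [hα])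
      (θ := fun y => -((p + 1) / (p - 1) - n / 2) * h + -(h / 4) * ‖y‖ ^ 2
        + inner ℝ ((1 / 2 : ℝ) • y₀) y)
      (θ' := fun y => -((p + 1) / (p - 1) - n / 2) * (h' + h ^ 2) - 1 / 2 * ‖y₀‖ ^ 2
        + -(h' / 4 + h ^ 2 / 2) * ‖y‖ ^ 2 + inner ℝ (h • y₀ + (1 / 2 : ℝ) • y₀') y)
      (η := fun y => -(2 / (p - 1) - n / 2) * h + -(h / 4) * ‖y‖ ^ 2
        + inner ℝ ((1 / 2 : ℝ) • y₀) y)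
      (η' := fun y => -(2 / (p - 1) - n / 2) * (h' + h ^ 2) - 1 / 2 * ‖y₀‖ ^ 2
        + -(h' / 4 + h ^ 2 / 2) * ‖y‖ ^ 2 + inner ℝ (h • y₀ + (1 / 2 : ℝ) • y₀') y)
      (fun y => by rw [quadPoly, real_inner_smul_left]; ring)
      (fun y => by rw [inner_add_left, real_inner_smul_left, real_inner_smul_left]; ring)
      (fun y => by rw [quadPoly, real_inner_smul_left, hα]; ring)
      (fun y => by rw [inner_add_left, real_inner_smul_left, real_inner_smul_left, hα]; ring)]
    have hrho : ∀ (α : ℝ) (y : Eucl n), gaussWeight (heatKappa α x t) (fun s => 1 / (4 * t s))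
        (fun s => (-1 / (2 * t s)) • x s) 0 y = rho y := fun α y => by
      rw [← rpow_mul_heatKernel α x t htn.self_of_nhds, ht.value, hx.value, sub_zero,
        heatKernel_neg_one, neg_neg, Real.one_rpow, one_mul]
    have gq : ∀ (c d : ℝ) (v : Eucl n), HasGrowth w 0 fun y => c + d * ‖y‖ ^ 2 + inner ℝ v y :=
      fun c d v => ((HasGrowth.const c).add (HasGrowth.id.norm_sq.const_mul d)).add
        ((HasGrowth.const v).inner HasGrowth.id)
    have gg := hw.hasGrowth_gradient
    have gw := hw.hasGrowth_self
    have g1 := hw.hasGrowth_abs_rpow (q := p - 1) (by linarith)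
    have g2 := hw.hasGrowth_abs_rpow (q := p + 1) (by linarith)
    -- Integrability of the three second derivatives, needed to merge their integrals into one.
    have j1 := ((((gdφ.norm_sq.const_mul 2).add (((gq (-((p + 1) / (p - 1) - n / 2) * h)
      (-(h / 4)) ((1 / 2 : ℝ) • y₀)).const_mul 2).mul ((gg.inner gdφ).const_mul 2))).add
      (((gq (-((p + 1) / (p - 1) - n / 2) * (h' + h ^ 2) - 1 / 2 * ‖y₀‖ ^ 2)
        (-(h' / 4 + h ^ 2 / 2)) (h • y₀ + (1 / 2 : ℝ) • y₀')).add
        (gq (-((p + 1) / (p - 1) - n / 2) * h)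
      (-(h / 4)) ((1 / 2 : ℝ) • y₀)).sq).mul gg.norm_sq)).gaussIntegrable (by norm_num)
      G).integrable_mul_rho.const_mul (1 / 2)
    have j2 := (((((((g1.const_mul p).mul gφ).mul gφ).const_mul (p + 1)).add
      (((gq (-((p + 1) / (p - 1) - n / 2) * h)
      (-(h / 4)) ((1 / 2 : ℝ) • y₀)).const_mul 2).mul
        (((g1.mul gw).mul gφ).const_mul (p + 1)))).add
      (((gq (-((p + 1) / (p - 1) - n / 2) * (h' + h ^ 2) - 1 / 2 * ‖y₀‖ ^ 2)
        (-(h' / 4 + h ^ 2 / 2)) (h • y₀ + (1 / 2 : ℝ) • y₀')).add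
        (gq (-((p + 1) / (p - 1) - n / 2) * h)
      (-(h / 4)) ((1 / 2 : ℝ) • y₀)).sq).mul g2)).gaussIntegrable (by norm_num)
      G).integrable_mul_rho.const_mul (-(1 / (p + 1)))
    have j3 := ((((gφ.sq.const_mul 2).add (((gq (-(2 / (p - 1) - n / 2) * h)
      (-(h / 4)) ((1 / 2 : ℝ) • y₀)).const_mul 2).mul ((gw.const_mul 2).mul gφ))).add
      (((gq (-(2 / (p - 1) - n / 2) * (h' + h ^ 2) - 1 / 2 * ‖y₀‖ ^ 2)
        (-(h' / 4 + h ^ 2 / 2)) (h • y₀ + (1 / 2 : ℝ) • y₀')).add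
        (gq (-(2 / (p - 1) - n / 2) * h)
      (-(h / 4)) ((1 / 2 : ℝ) • y₀)).sq).mul gw.sq)).gaussIntegrable (by norm_num)
      G).integrable_mul_rho.const_mul (1 / (2 * (p - 1)))
    simp only [hrho, zero_smul, zero_mul, add_zero]
    simp only [mul_comm (rho _)]
    rw [← integral_const_mul, ← integral_const_mul, ← integral_const_mul,
      ← integral_add j1 j2, ← integral_add (j1.fun_add j2) j3]
    refine integral_congr_ae (Eventually.of_forall fun y => ?_)
    simp only [secondDensity]
    ring

end

end SelfSimilar

/-! ### The second variation formula. -/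

theorem theorem4p3 (n : ℕ) (hn : 3 ≤ n) (p : ℝ) (hp : ((n : ℝ) + 2) / ((n : ℝ) - 2) < p)
    (w : SelfSimilar.Eucl n → ℝ) (hw : SelfSimilar.IsBoundedSolution p w)
    (x : ℝ → SelfSimilar.Eucl n) (t : ℝ → ℝ)
    (y₀ y₀' : SelfSimilar.Eucl n) (h h' : ℝ)
    (hx : SelfSimilar.IsVariation x 0 y₀ y₀') (ht : SelfSimilar.IsVariation t (-1) h h')
    (φ : SelfSimilar.Eucl n → ℝ) (hφ : ContDiff ℝ ∞ φ) (hφc : HasCompactSupport φ) :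
    -- all the integrals involved converge (those with a factor `φ` or `∇φ` trivially do)
    (∀ᶠ s in 𝓝 (0 : ℝ), SelfSimilar.FiniteF p (x s) (t s) (fun y => w y + s * φ y)) ∧
    Integrable (fun y => (inner ℝ (gradient w y) y₀) ^ 2 * SelfSimilar.rho y) ∧
    Integrable (fun y => (1 / (p - 1) * w y + 1 / 2 * inner ℝ y (gradient w y)) ^ 2
      * SelfSimilar.rho y) ∧
    -- the function `s ↦ F_{x(s),t(s)}(w + sφ)` is twice differentiable at `0`, with the
    -- stated second derivative
    (∀ᶠ s in 𝓝 (0 : ℝ), DifferentiableAt ℝ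
      (fun s : ℝ => SelfSimilar.functionalF p (x s) (t s) (fun y => w y + s * φ y)) s) ∧
    HasDerivAt
      (deriv fun s : ℝ => SelfSimilar.functionalF p (x s) (t s) (fun y => w y + s * φ y))
      (SelfSimilar.quadQ p w φ
        + h * (∫ y, SelfSimilar.Lam p w y * φ y * SelfSimilar.rho y)
        - (∫ y, φ y * inner ℝ (gradient w y) y₀ * SelfSimilar.rho y)
        - 1 / 2 * (∫ y, (inner ℝ (gradient w y) y₀) ^ 2 * SelfSimilar.rho y)
        - h ^ 2 * (∫ y, (1 / (p - 1) * w y + 1 / 2 * inner ℝ y (gradient w y)) ^ 2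
            * SelfSimilar.rho y))
      0 ∧
    deriv (deriv fun s : ℝ =>
        SelfSimilar.functionalF p (x s) (t s) (fun y => w y + s * φ y)) 0 ≤
      SelfSimilar.quadQ p w φ
        + h * (∫ y, SelfSimilar.Lam p w y * φ y * SelfSimilar.rho y)
        - (∫ y, φ y * inner ℝ (gradient w y) y₀ * SelfSimilar.rho y) := by
  have hn' : (3 : ℝ) ≤ n := by exact_mod_cast hn
  have hp1 : 1 < p := by
    refine lt_trans ?_ hp
    rw [lt_div_iff₀ (by linarith)]
    linarith
  have G := hw.gaussIntegrable_gradient hp1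
  obtain ⟨hfin, a, v, hV⟩ := hw.isVariation_functionalF hp1 hx ht hφ hφc
  have gφ : SelfSimilar.HasGrowth w 0 φ :=
    SelfSimilar.HasGrowth.of_hasCompactSupport hφ.continuous hφc
  have gdφ := SelfSimilar.HasGrowth.gradient_of_hasCompactSupport (w := w) hφ hφc
  rw [(hw.integral_variationDensity hp1 gφ gdφ y₀ h).2] at hV
  refine ⟨hfin, ((hw.hasGrowth_inner_gradient y₀).sq.gaussIntegrable le_rfl G).integrable_mul_rho,
    (hw.hasGrowth_dilation.sq.gaussIntegrable le_rfl G).integrable_mul_rho,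
    hV.differentiable_near, hV.second_deriv, ?_⟩
  rw [hV.second_deriv.deriv]
  have h1 : 0 ≤ ∫ y, (inner ℝ (gradient w y) y₀) ^ 2 * SelfSimilar.rho y :=
    integral_nonneg fun y => mul_nonneg (sq_nonneg _) (SelfSimilar.rho_pos y).le
  have h2 : 0 ≤ h ^ 2 * ∫ y, (1 / (p - 1) * w y + 1 / 2 * inner ℝ y (gradient w y)) ^ 2
      * SelfSimilar.rho y :=
    mul_nonneg (sq_nonneg _)
      (integral_nonneg fun y => mul_nonneg (sq_nonneg _) (SelfSimilar.rho_pos y).le)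
  linarith
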